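/- Let $n\ge 3$ and let $\mathcal F$ be one of the following rings of germs at $0$ of functions on $\mathbb K^n$: germs of holomorphic functions ($\mathbb K=\mathbb C$), germs of real analytic functions ($\mathbb K=\mathbb R$), germs of real $C^\infty$ functions ($\mathbb K=\mathbb R$), or formal power series ($\mathbb K=\mathbb R$ or $\mathbb C$). Let $\Omega^k$ denote the corresponding space of germs of $k$-forms, and put $\omega=dx_1\wedge\dots\wedge dx_n$. Fix positive integer weights $w_1,\dots,w_n$; the monomial $x_1^{m_1}\cdots x_n^{m_n}$ has degree $\sum_i m_iw_i$, and a polynomial is quasihomogeneous of degree $D\in\mathbb Z$ if all its monomials have degree $D$ (so the zero polynomial is quasihomogeneous of every degree). Let $f$ be a polynomial with $f(0)=0$ which is quasihomogeneous of degree $N$ and of finite codimension, i.e. $Q_f=\mathcal F/(\partial f/\partial x_1,\dots,\partial f/\partial x_n)$ is finite-dimensional over $\mathbb K$; put $c=\dim_{\mathbb K} Q_f$. Let $\mathcal B$ be a finite set of monomials whose classes form a basis of $Q_f$, let $r_j$ be the number of monomials in $\mathcal B$ of degree $jN-\sum_i w_i$, and let $s$ be the dimension of the space of quasihomogeneous polynomials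 of degree $N-\sum_i w_i$. For $p\in\mathbb Z$ let $d_f^{(p)}:\Omega^k\to\Omega^{k+1}$, $d_f^{(p)}\alpha=f\,d\alpha-(k-p)\,df\wedge\alpha$, and let $B^k_{f,p}=d_f^{(p)}(\Omega^{k-1})$, $Z^k_{f,p}=\ker(d_f^{(p)}|_{\Omega^k})$ and $H^k_{f,p}=Z^k_{f,p}/B^k_{f,p}$. Let $q>1$ be an integer. Then for every $\alpha\in\Omega^n$ there exist unique polynomials $h_1,\dots,h_q$ (possibly zero) such that - $h_1$ is quasihomogeneous of degree $N-\sum_i w_i$, - for $2\le j\le q-1$, $h_j$ is a linear combination of monomials of $\mathcal B$ of degree $jN-\sum_i w_i$, - $h_q$ is a linear combination of monomials of $\mathcal B$, and $$\alpha=(h_q+f h_{q-1}+\dots+f^{q-1}h_1)\,\omega \quad\bmod B^n_{f,n-q}.$$ In particular $H^n_{f,n-q}$ is finite-dimensional over $\mathbb K$, and $\dim H^n_{f,n-q}=c+r_{q-1}+\dots+r_2+s$ (which is $c+s$ if $q=2$). -/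

import Mathlib

open Filter Topology
open scoped ContDiff

namespace NambuPoisson

noncomputable section

/-! ### Rings of germs of functions at the origin of `𝕜ⁿ` -/

/-- A commutative `𝕜`-algebra (of germs of functions at `0 ∈ 𝕜ⁿ`) together with its coordinate
functions `x₁, …, xₙ` and its partial derivatives `∂/∂x₁, …, ∂/∂xₙ`.  Only the concrete instances
listed in `IsGermRing` below are used. -/
structure FunctionRing (𝕜 : Type) [Field 𝕜] (n : ℕ) where
  /-- the underlying set of germs -/
  carrier : Type
  [commRing : CommRing carrier]
  [algebra : Algebra 𝕜 carrier]
  /-- the coordinate functions -/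
  coord : Fin n → carrier
  /-- the partial derivatives -/
  pd : Fin n → Derivation 𝕜 carrier carrier

attribute [instance] FunctionRing.commRing FunctionRing.algebra

section Germs

variable (𝕜 : Type) [RCLike 𝕜] (n : ℕ)

/-- Germs at `0` of arbitrary functions form an algebra under pointwise operations. -/
instance germAlgebra : Algebra 𝕜 (Germ (𝓝 (0 : Fin n → 𝕜)) 𝕜) :=
  Algebra.ofModule
    (fun r a b => by
      induction a using Germ.inductionOn with | _ a =>
      induction b using Germ.inductionOn with | _ b =>
      exact congrArg _ (smul_mul_assoc r a b))
    (fun r a b => by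
      induction a using Germ.inductionOn with | _ a =>
      induction b using Germ.inductionOn with | _ b =>
      exact congrArg _ (mul_smul_comm r a b))

/-- The algebra of germs at `0 ∈ 𝕜ⁿ` of functions which are of class `C^r` over `𝕜` on a
neighbourhood of `0`. -/
def germSubalgebra (r : WithTop ℕ∞) : Subalgebra 𝕜 (Germ (𝓝 (0 : Fin n → 𝕜)) 𝕜) where
  carrier := {g | ∃ a : (Fin n → 𝕜) → 𝕜, (∀ᶠ x in 𝓝 0, ContDiffAt 𝕜 r a x) ∧ (a : Germ _ _) = g}
  mul_mem' := by
    rintro _ _ ⟨a, ha, rfl⟩ ⟨b, hb, rfl⟩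
    exact ⟨a * b, by filter_upwards [ha, hb] with x h₁ h₂ using h₁.mul h₂, rfl⟩
  add_mem' := by
    rintro _ _ ⟨a, ha, rfl⟩ ⟨b, hb, rfl⟩
    exact ⟨a + b, by filter_upwards [ha, hb] with x h₁ h₂ using h₁.add h₂, rfl⟩
  algebraMap_mem' c := by
    refine ⟨c • (1 : (Fin n → 𝕜) → 𝕜), .of_forall fun x => ?_, ?_⟩
    · exact contDiffAt_const (c := c • (1 : 𝕜))
    · rw [Algebra.algebraMap_eq_smul_one]; rfl

/-- The partial derivative `∂/∂xᵢ` on germs of functions. -/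
def germPartial (i : Fin n) :
    Germ (𝓝 (0 : Fin n → 𝕜)) 𝕜 → Germ (𝓝 (0 : Fin n → 𝕜)) 𝕜 :=
  Germ.map' (fun a x => fderiv 𝕜 a x (Pi.single i 1)) (by
    intro a b hab
    filter_upwards [EventuallyEq.fderiv (𝕜 := 𝕜) hab] with x hx
    rw [hx])

variable {r : WithTop ℕ∞}

/-- `∂/∂xᵢ` as a derivation of the algebra of germs of class `C^r`, for `r = ∞` or `r = ω`
(the orders with `r + 1 ≤ r`). -/
def germDerivation (hr : r + 1 ≤ r) (i : Fin n) :
    Derivation 𝕜 (germSubalgebra 𝕜 n r) (germSubalgebra 𝕜 n r) :=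
  have hr1 : r ≠ 0 := by rintro rfl; simp at hr
  Derivation.mk'
    { toFun := fun g => ⟨germPartial 𝕜 n i g, by
        obtain ⟨_, a, ha, rfl⟩ := g
        refine ⟨fun x => fderiv 𝕜 a x (Pi.single i 1), ?_, rfl⟩
        filter_upwards [ha] with x hx
        exact (hx.fderiv_right hr).clm_apply contDiffAt_const⟩
      map_add' := by
        rintro ⟨_, a, ha, rfl⟩ ⟨_, b, hb, rfl⟩
        refine Subtype.ext (Germ.coe_eq.2 ?_)
        filter_upwards [ha, hb] with x h₁ h₂
        change fderiv 𝕜 (a + b) x _ = fderiv 𝕜 a x _ + fderiv 𝕜 b x _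
        rw [fderiv_add (h₁.differentiableAt hr1) (h₂.differentiableAt hr1)]
        rfl
      map_smul' := by
        rintro c ⟨_, a, ha, rfl⟩
        refine Subtype.ext (Germ.coe_eq.2 ?_)
        filter_upwards [ha] with x h₁
        change fderiv 𝕜 (c • a) x _ = c • fderiv 𝕜 a x _
        rw [fderiv_const_smul (h₁.differentiableAt hr1)]
        rfl }
    (by
      rintro ⟨_, a, ha, rfl⟩ ⟨_, b, hb, rfl⟩
      refine Subtype.ext (Germ.coe_eq.2 ?_)
      filter_upwards [ha, hb] with x h₁ h₂
      change fderiv 𝕜 (a * b) x _ = a x * fderiv 𝕜 b x _ + b x * fderiv 𝕜 a x _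
      rw [fderiv_mul (h₁.differentiableAt hr1) (h₂.differentiableAt hr1)]
      rfl)

/-- The ring of germs at `0 ∈ 𝕜ⁿ` of functions of class `C^r`, for `r = ∞` or `r = ω`. -/
def germRing (r : WithTop ℕ∞) (hr : r + 1 ≤ r) : FunctionRing 𝕜 n where
  carrier := germSubalgebra 𝕜 n r
  coord i := ⟨((fun x : Fin n → 𝕜 => x i) : (Fin n → 𝕜) → 𝕜),
    fun x => x i, .of_forall fun _ => contDiffAt_apply .., rfl⟩
  pd := germDerivation 𝕜 n hr

/-- Germs of analytic functions (holomorphic functions if `𝕜 = ℂ`). -/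
def analyticGerms : FunctionRing 𝕜 n := germRing 𝕜 n ω le_top

/-- Germs of real `C^∞` functions. -/
def smoothGerms : FunctionRing ℝ n := germRing ℝ n ∞ le_rfl

/-- Formal power series. -/
def formalGerms : FunctionRing 𝕜 n where
  carrier := MvPowerSeries (Fin n) 𝕜
  coord := MvPowerSeries.X
  pd := MvPowerSeries.pderiv 𝕜

/-- The rings of germs under consideration, over `𝕜 = ℝ` or `ℂ`: germs of holomorphic functions
on `ℂⁿ`, of real analytic functions on `ℝⁿ`, of `C^∞` functions on `ℝⁿ`, and formal power series
over `ℝ` or `ℂ`. -/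
inductive IsGermRing (n : ℕ) : (𝕜 : Type) → [RCLike 𝕜] → FunctionRing 𝕜 n → Prop
  | holomorphic : IsGermRing n ℂ (analyticGerms ℂ n)
  | realAnalytic : IsGermRing n ℝ (analyticGerms ℝ n)
  | smooth : IsGermRing n ℝ (smoothGerms n)
  | formal (𝕜 : Type) [RCLike 𝕜] : IsGermRing n 𝕜 (formalGerms 𝕜 n)

end Germs

variable {𝕜 : Type} [Field 𝕜] {n : ℕ}

namespace FunctionRing

variable (𝓕 : FunctionRing 𝕜 n)

/-- The germ of a polynomial. -/
def ofPoly : MvPolynomial (Fin n) 𝕜 →ₐ[𝕜] 𝓕.carrier := MvPolynomial.aeval 𝓕.coord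

/-! ### Differential forms and the operators `d_f^{(p)}` -/

/-- Germs of differential `k`-forms: `α = ∑ α_I dx_I`, the sum being over the `k`-element subsets
`I = {i₁ < ⋯ < i_k}` of `{1, …, n}`, with `dx_I = dx_{i₁} ∧ ⋯ ∧ dx_{i_k}`; the form is given by
its coefficients `α_I`. -/
abbrev Form (k : ℕ) : Type := {I : Finset (Fin n) // I.card = k} → 𝓕.carrier

/-- For `i ∈ J` the sign `ε` in `dx_i ∧ dx_{J \ {i}} = ε dx_J`. -/
def insertSign (J : Finset (Fin n)) (i : Fin n) : ℤ := (-1) ^ (J.filter (· < i)).card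

variable {𝓕}

/-- Removing an element from a set of `k + 1` indices. -/
def eraseIdx {k : ℕ} (J : {J : Finset (Fin n) // J.card = k + 1}) (i : J.1) :
    {I : Finset (Fin n) // I.card = k} :=
  ⟨J.1.erase i, by rw [Finset.card_erase_of_mem i.2, J.2, Nat.add_sub_cancel]⟩

variable (𝓕)

/-- The exterior derivative `d (∑ α_I dx_I) = ∑_I ∑_i ∂α_I/∂x_i dx_i ∧ dx_I`. -/
def extD (k : ℕ) : 𝓕.Form k →ₗ[𝕜] 𝓕.Form (k + 1) where
  toFun α J := ∑ i : J.1, insertSign J.1 i • 𝓕.pd i (α (eraseIdx J i))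
  map_add' α β := by
    ext J; simp [Finset.sum_add_distrib]
  map_smul' c α := by
    ext J; simp [Finset.smul_sum]

/-- The operator `α ↦ df ∧ α = ∑_I ∑_i (∂f/∂x_i) α_I dx_i ∧ dx_I`. -/
def dWedge (f : 𝓕.carrier) (k : ℕ) : 𝓕.Form k →ₗ[𝕜] 𝓕.Form (k + 1) where
  toFun α J := ∑ i : J.1, insertSign J.1 i • (𝓕.pd i f * α (eraseIdx J i))
  map_add' α β := by
    ext J; simp [mul_add, Finset.sum_add_distrib]
  map_smul' c α := by
    ext J; simp [Finset.smul_sum]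

/-- `d_f^{(p)} α = f dα - (k - p) df ∧ α` for a `k`-form `α`. -/
def twistedD (f : 𝓕.carrier) (p : ℤ) (k : ℕ) : 𝓕.Form k →ₗ[𝕜] 𝓕.Form (k + 1) :=
  f • 𝓕.extD k - ((k : ℤ) - p) • 𝓕.dWedge f k

/-- The cocycles `Z^k_{f,p}`. -/
def cocycles (f : 𝓕.carrier) (p : ℤ) (k : ℕ) : Submodule 𝕜 (𝓕.Form k) :=
  LinearMap.ker (𝓕.twistedD f p k)

/-- The coboundaries `B^k_{f,p}`. -/
def coboundaries (f : 𝓕.carrier) (p : ℤ) : (k : ℕ) → Submodule 𝕜 (𝓕.Form k)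
  | 0 => ⊥
  | k + 1 => LinearMap.range (𝓕.twistedD f p k)

/-- The cohomology `H^k_{f,p} = Z^k_{f,p} / B^k_{f,p}`. -/
abbrev Cohomology (f : 𝓕.carrier) (p : ℤ) (k : ℕ) : Type :=
  𝓕.cocycles f p k ⧸ (𝓕.coboundaries f p k).submoduleOf (𝓕.cocycles f p k)

/-- The `n`-form `g ω`, where `ω = dx₁ ∧ ⋯ ∧ dxₙ` is the standard volume form. -/
def volForm (g : 𝓕.carrier) : 𝓕.Form n := fun _ => g

/-! ### Finite codimension and monomial bases -/

/-- The ideal `I_f` spanned by the partial derivatives of `f`. -/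
def jacobianIdeal (f : 𝓕.carrier) : Ideal 𝓕.carrier := Ideal.span (Set.range fun i => 𝓕.pd i f)

/-- The quotient `Q_f` of the ring of germs by `I_f`; its dimension is the codimension of `f`. -/
abbrev MilnorAlgebra (f : 𝓕.carrier) : Type := 𝓕.carrier ⧸ 𝓕.jacobianIdeal f

/-- The class in `Q_f` of the monomial with exponent `m`. -/
def monomialClass (f : 𝓕.carrier) (m : Fin n →₀ ℕ) : 𝓕.MilnorAlgebra f :=
  Ideal.Quotient.mk _ (𝓕.ofPoly (MvPolynomial.monomial m 1))

/-- The classes of the monomials in `𝓑` (given by their exponents) form a basis of `Q_f`. -/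
def IsMonomialBasis (f : 𝓕.carrier) (𝓑 : Finset (Fin n →₀ ℕ)) : Prop :=
  LinearIndependent 𝕜 (fun m : 𝓑 => 𝓕.monomialClass f m) ∧
    Submodule.span 𝕜 (𝓕.monomialClass f '' 𝓑) = ⊤

end FunctionRing

/-- The elements of `𝓑` of quasidegree `D` with respect to the weights `w`. -/
def ofDegree (w : Fin n → ℤ) (𝓑 : Finset (Fin n →₀ ℕ)) (D : ℤ) : Finset (Fin n →₀ ℕ) :=
  𝓑.filter fun m => Finsupp.weight w m = D

variable (𝕜) in
/-- The linear combinations of the monomials in `𝓑`. -/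
def monomialSpan (𝓑 : Finset (Fin n →₀ ℕ)) : Submodule 𝕜 (MvPolynomial (Fin n) 𝕜) :=
  Submodule.span 𝕜 ((fun m => MvPolynomial.monomial m 1) '' (𝓑 : Set (Fin n →₀ ℕ)))

end

end NambuPoisson

/-! Identify `n`-forms with functions and `(n-1)`-forms with vector fields. Then `d_f^{(n-q)}`
becomes `D_t X = f div X - t X(f)` with `t = q - 1`, and the question is its cokernel. Put `W = ∑
w_i` and let `E` be the Euler field. Three facts drive everything: `D_t(f Y) = f D_{t-1}(Y)`; `D_t(u
E) = f (E u + (W - t N) u)`; and, for `t ≥ 1`, `X(f)` is congruent to `f div X / t` modulo the image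
of `D_t`.

Existence (`exists_normalForm`, `exists_coeffs`): write `g = b + Z(f)` with `b` spanned by `𝓑`, and
trade `Z(f)` for `f div Z / t`. Since `E + l` is onto up to quasihomogeneous polynomials of degree
`-l` (`exists_euler_add_poly`), the factor `div Z / t` may be replaced by a quasihomogeneous
polynomial of degree `t N - W`, which matters only modulo `D_{t-1}`. Repeating, now among
quasihomogeneous polynomials, ends at twist `0` with a polynomial of degree `N - W`, which is `h_1`.

Uniqueness (`normalForm_eq_zero`): Taylor truncation and grading reduce it to polynomials
(`exists_poly_of_twistedDiv_eq`). The leading coefficient of a trivial normal form lies in the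
Jacobian ideal, because `f = E(f) / N` does, so it vanishes. There remains `f G = D_t Y` with `G` of
degree `t N - W`. The Jacobian ideal contains powers of all coordinates, a regular sequence, so by
Koszul exactness a field killing `f` is `∑ A_ij ∂_j f` with `A` antisymmetric. Applied to `(G - div
Y) E + t N Y`, this gives `G = V(f)` with `div V = 0` (`exists_divFree_of_mul_eq`). Again the
leading coefficient of `G` vanishes, and `V(f)` is a multiple of `D_{t-1} V`, so one descends to
`h_1 = V(f)`, where degrees force `V = 0`.

About the ring of germs only `IsEulerRing` is used. For functions, `(E + l) u = g` is solved by
integrating `s^(l-1) g` along the weighted dilations. -/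

namespace NambuPoisson

/-! ### Koszul chains -/

namespace Koszul

variable {R : Type*} [CommRing R] {n : ℕ}

/-- The sign `(-1)^#{j ∈ J | j < i}`. -/
def sgn (J : Finset (Fin n)) (i : Fin n) : R := (-1) ^ (J.filter (· < i)).card

theorem sgn_mul_self (J : Finset (Fin n)) (i : Fin n) : (sgn J i : R) * sgn J i = 1 := by
  rw [sgn, ← mul_pow]; simp

theorem sgn_insert {J : Finset (Fin n)} {i : Fin n} (hi : i ∉ J) (j : Fin n) :
    (sgn (insert i J) j : R) = if i < j then -sgn J j else sgn J j := by
  unfold sgn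
  rw [Finset.filter_insert]
  split_ifs with h
  · rw [Finset.card_insert_of_notMem (by simp [hi]), pow_succ]; ring
  · rfl

theorem sgn_erase {J : Finset (Fin n)} {i : Fin n} (hi : i ∈ J) (j : Fin n) :
    (sgn (J.erase i) j : R) = if i < j then -sgn J j else sgn J j := by
  conv_rhs => rw [← Finset.insert_erase hi, sgn_insert (Finset.notMem_erase i J)]
  split_ifs <;> simp

/-- Contraction of a chain with the covector `θ`. -/
def contr (θ : Fin n → R) (z : Finset (Fin n) → R) (I : Finset (Fin n)) : R :=
  ∑ i, if i ∈ I then 0 else θ i * (sgn I i * z (insert i I))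

/-- Left multiplication of a chain by the vector `a`. -/
def wedge (a : Fin n → R) (z : Finset (Fin n) → R) (J : Finset (Fin n)) : R :=
  ∑ i, if i ∈ J then a i * (sgn J i * z (J.erase i)) else 0

/-- The homotopy identity: off-diagonal terms of the two composites cancel in pairs, while each
diagonal index contributes `a i * θ i * z J` through exactly one of them, according to whether `i ∈
J`. Hence the ideal generated by `θ` acts by zero on Koszul homology. -/
theorem wedge_contr (a θ : Fin n → R) (z : Finset (Fin n) → R) (J : Finset (Fin n)) :
    wedge a (contr θ z) J + contr θ (wedge a z) J = (∑ i, a i * θ i) * z J := by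
  have h1 : wedge a (contr θ z) J = ∑ i, ∑ j, if i ∈ J then
      (if j ∈ J.erase i then 0 else
        a i * (sgn J i * (θ j * (sgn (J.erase i) j * z (insert j (J.erase i)))))) else 0 := by
    refine Finset.sum_congr rfl fun i _ => ?_
    split_ifs with h
    · rw [contr, Finset.mul_sum, Finset.mul_sum]
      refine Finset.sum_congr rfl fun j _ => ?_
      split_ifs <;> simp
    · simp
  have h2 : contr θ (wedge a z) J = ∑ i, ∑ j, if j ∈ J then 0 else
      (if i ∈ insert j J then
        θ j * (sgn J j * (a i * (sgn (insert j J) i * z ((insert j J).erase i)))) else 0) := by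
    rw [Finset.sum_comm]
    refine Finset.sum_congr rfl fun j _ => ?_
    split_ifs with h
    · simp
    · rw [wedge, Finset.mul_sum, Finset.mul_sum]
      refine Finset.sum_congr rfl fun i _ => ?_
      split_ifs <;> simp
  rw [h1, h2, ← Finset.sum_add_distrib, Finset.sum_mul]
  refine Finset.sum_congr rfl fun i _ => ?_
  rw [← Finset.sum_add_distrib, Finset.sum_eq_single i]
  · by_cases hi : i ∈ J
    · simp only [hi, Finset.mem_erase, if_true, ne_eq, not_true, false_and, if_false, add_zero,
        Finset.insert_erase, sgn_erase hi, lt_irrefl]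
      linear_combination (a i * θ i * z J) * sgn_mul_self (R := R) J i
    · simp only [hi, Finset.mem_insert, true_or, if_true, if_false, zero_add,
        Finset.erase_insert hi, sgn_insert hi, lt_irrefl]
      linear_combination (a i * θ i * z J) * sgn_mul_self (R := R) J i
  · intro j _ hji
    by_cases hi : i ∈ J
    · by_cases hj : j ∈ J
      · simp [hi, hj, hji]
      · have hij : i ≠ j := hji.symm
        simp only [hi, hj, Finset.mem_erase, Finset.mem_insert, if_true, if_false, and_false,
          or_true, sgn_erase hi, sgn_insert hj, Finset.erase_insert_of_ne hji]
        rcases lt_or_gt_of_ne hij with h | h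
        · simp only [h, h.not_gt, if_true, if_false]; ring
        · simp only [h, h.not_gt, if_true, if_false]; ring
    · have hij : i ≠ j := hji.symm
      simp [hi, hij]
  · simp

theorem contr_contr (θ : Fin n → R) (z : Finset (Fin n) → R) (J : Finset (Fin n)) :
    contr θ (contr θ z) J = 0 := by
  set T : Fin n → Fin n → R := fun i j => if i ∈ J then 0 else
      (if j ∈ insert i J then 0 else
        θ i * (sgn J i * (θ j * (sgn (insert i J) j * z (insert j (insert i J)))))) with hT
  have h1 : contr θ (contr θ z) J = ∑ i, ∑ j, T i j := by
    refine Finset.sum_congr rfl fun i _ => ?_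
    simp only [hT]
    split_ifs with h
    · simp
    · rw [contr, Finset.mul_sum, Finset.mul_sum]
      refine Finset.sum_congr rfl fun j _ => ?_
      split_ifs <;> simp
  have hself : ∀ i, T i i = 0 := fun i => by simp [hT]
  have hanti : ∀ i j, i < j → T i j + T j i = 0 := by
    intro i j h
    by_cases hi : i ∈ J
    · simp [hT, hi]
    by_cases hj : j ∈ J
    · simp [hT, hj]
    simp only [hT, hi, hj, Finset.mem_insert, h.ne, h.ne', if_false, or_self, sgn_insert hi,
      sgn_insert hj, h, h.not_gt, if_true, Finset.insert_comm i j]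
    ring
  rw [h1, ← Finset.sum_product']
  refine Finset.sum_ninvolution (fun p => (p.2, p.1)) (fun p => ?_) ?_ ?_ ?_
  · rcases lt_trichotomy p.1 p.2 with h | h | h
    · exact hanti _ _ h
    · rw [h, hself]; simp
    · rw [add_comm]; exact hanti _ _ h
  · rintro ⟨i, j⟩ hne h
    simp only [Prod.mk.injEq] at h
    obtain ⟨rfl, -⟩ := h
    exact hne (hself _)
  · simp
  · simp

theorem contr_add (θ : Fin n → R) (z z' : Finset (Fin n) → R) (I : Finset (Fin n)) :
    contr θ (z + z') I = contr θ z I + contr θ z' I := by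
  rw [contr, contr, contr, ← Finset.sum_add_distrib]
  refine Finset.sum_congr rfl fun i _ => ?_
  split_ifs
  · simp
  · simp only [Pi.add_apply]; ring

theorem contr_smul (θ : Fin n → R) (c : R) (z : Finset (Fin n) → R) (I : Finset (Fin n)) :
    contr θ (c • z) I = c * contr θ z I := by
  rw [contr, contr, Finset.mul_sum]
  refine Finset.sum_congr rfl fun i _ => ?_
  split_ifs
  · simp
  · simp only [Pi.smul_apply, smul_eq_mul]; ring

theorem contr_mem {K : Ideal R} (θ : Fin n → R) {z : Finset (Fin n) → R} (hz : ∀ I, z I ∈ K)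
    (I : Finset (Fin n)) : contr θ z I ∈ K := by
  refine K.sum_mem fun i _ => ?_
  split_ifs
  · exact K.zero_mem
  · exact K.mul_mem_left _ (K.mul_mem_left _ (hz _))

theorem wedge_mem {K : Ideal R} (a : Fin n → R) {z : Finset (Fin n) → R} (hz : ∀ I, z I ∈ K)
    (I : Finset (Fin n)) : wedge a z I ∈ K := by
  refine K.sum_mem fun i _ => ?_
  split_ifs
  · exact K.mul_mem_left _ (K.mul_mem_left _ (hz _))
  · exact K.zero_mem

theorem wedge_eq_zero (a : Fin n → R) {z : Finset (Fin n) → R} {d : ℕ}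
    (hz : ∀ I, I.card ≠ d → z I = 0) (J : Finset (Fin n)) (hJ : J.card ≠ d + 1) :
    wedge a z J = 0 := by
  refine Finset.sum_eq_zero fun i _ => ?_
  split_ifs with h
  · have := Finset.card_erase_add_one h
    rw [hz _ (by omega)]; simp
  · rfl

theorem contr_eq_zero (θ : Fin n → R) {z : Finset (Fin n) → R} {d : ℕ}
    (hz : ∀ I, I.card ≠ d + 1 → z I = 0) (J : Finset (Fin n)) (hJ : J.card ≠ d) :
    contr θ z J = 0 := by
  refine Finset.sum_eq_zero fun i _ => ?_
  split_ifs with h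
  · rfl
  · rw [hz _ (by rw [Finset.card_insert_of_notMem h]; omega)]; simp

/-- Exactness of the Koszul complex of `θ` modulo an initial part of a regular sequence contained
in the ideal generated by `θ`. -/
theorem exact_mod (θ y : Fin n → R) (hmem : ∀ k, ∃ a : Fin n → R, ∑ i, a i * θ i = y k)
    (hreg : ∀ k r, y k * r ∈ Ideal.span (y '' {i | i < k}) →
      r ∈ Ideal.span (y '' {i | i < k})) (d : ℕ) :
    ∀ (k p : ℕ), k + d = n → k + 1 ≤ p → ∀ z : Finset (Fin n) → R,
      (∀ I, I.card ≠ p → z I = 0) →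
      (∀ I, contr θ z I ∈ Ideal.span (y '' {i | i.val < k})) →
      ∃ v : Finset (Fin n) → R, (∀ I, I.card ≠ p + 1 → v I = 0) ∧
        ∀ I, z I - contr θ v I ∈ Ideal.span (y '' {i | i.val < k}) := by
  -- Downward induction on the number `k = n - d` of elements divided out. For `k = n` the chain has
  -- degree `p > n` and is zero.
  induction d with
  | zero =>
    intro k p hk hp z hz _
    refine ⟨0, fun _ _ => rfl, fun I => ?_⟩
    have h0 : z I = 0 := hz I (by have := I.card_le_univ; simp at this; omega)
    have : contr θ 0 I = 0 := by simp [contr]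
    rw [h0, this, sub_zero]
    exact Ideal.zero_mem _
  | succ d ih =>
    intro k p hk hp z hz hcyc
    set κ : Fin n := ⟨k, by omega⟩ with hκ
    set K : Ideal R := Ideal.span (y '' {i | i.val < k}) with hK
    have hKκ : K = Ideal.span (y '' {i | i < κ}) := rfl
    have hsucc : Ideal.span (y '' {i : Fin n | i.val < k + 1}) = Ideal.span {y κ} ⊔ K := by
      have : {i : Fin n | i.val < k + 1} = insert κ {i | i.val < k} := by
        ext i; simp only [Set.mem_ofPred_eq, Set.mem_insert_iff, Fin.ext_iff, hκ]; omega
      rw [this, Set.image_insert_eq, Ideal.span_insert]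
    obtain ⟨a, ha⟩ := hmem κ
    have hhom : ∀ I, y κ * z I - contr θ (wedge a z) I ∈ K := fun I => by
      have := wedge_contr a θ z I
      rw [ha] at this
      rw [← this, add_sub_cancel_right]
      exact wedge_mem a hcyc I
    -- By the homotopy, `wedge a z` is a cycle modulo `K` and `y κ`, and its degree is one higher,
    -- as the induction hypothesis for `k + 1` requires.
    obtain ⟨γ, hγ0, hγ⟩ := ih (k + 1) (p + 1) (by omega) (by omega) (wedge a z)
      (wedge_eq_zero a hz) (fun I => by
        rw [hsucc]
        have h1 : y κ * z I ∈ Ideal.span {y κ} ⊔ K :=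
          Ideal.mem_sup_left (Ideal.mul_mem_right _ _ (Ideal.subset_span rfl))
        have h2 : y κ * z I - contr θ (wedge a z) I ∈ Ideal.span {y κ} ⊔ K :=
          Ideal.mem_sup_right (hhom I)
        simpa using sub_mem h1 h2)
    have hdec : ∀ I, ∃ r e, e ∈ K ∧ wedge a z I - contr θ γ I = y κ * r + e := fun I => by
      have := hγ I
      rw [hsucc, Submodule.mem_sup] at this
      obtain ⟨s, hs, e, he, hse⟩ := this
      obtain ⟨r, rfl⟩ := Ideal.mem_span_singleton'.1 hs
      exact ⟨r, e, he, by rw [← hse, mul_comm]⟩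
    choose r e he hre using hdec
    -- The chosen `r` and `e` are arbitrary outside degree `p + 1`, so they are cut off there.
    set v : Finset (Fin n) → R := fun I => if I.card = p + 1 then r I else 0 with hv
    set e' : Finset (Fin n) → R := fun I => if I.card = p + 1 then e I else 0 with he'
    have hsum : wedge a z = contr θ γ + (y κ • v + e') := by
      funext I
      simp only [hv, he', Pi.add_apply, Pi.smul_apply, smul_eq_mul]
      split_ifs with h
      · rw [← hre]; ring
      · rw [wedge_eq_zero a hz I h, contr_eq_zero θ hγ0 I h]; simp
    refine ⟨v, fun I hI => by simp [hv, hI], fun I => ?_⟩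
    -- Contracting the decomposition `hsum` kills `contr θ γ`, so `y κ * (z I - contr θ v I)` lies
    -- in `K`, and regularity cancels `y κ`.
    rw [hKκ]
    apply hreg
    rw [← hKκ]
    have h1 := hhom I
    rw [hsum, contr_add, contr_contr, zero_add, contr_add, contr_smul] at h1
    have h2 : contr θ e' I ∈ K := contr_mem θ (fun I => by
      simp only [he']
      split_ifs
      · exact he I
      · exact K.zero_mem) I
    convert add_mem h1 h2 using 1
    ring

/-- If the ideal generated by `θ₁, …, θₙ` contains a regular sequence of length `n`, every
relation between the `θᵢ` is a combination of the trivial ones. -/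
theorem exists_antisymm_of_sum_mul_eq_zero (θ y : Fin n → R)
    (hmem : ∀ k, y k ∈ Ideal.span (Set.range θ))
    (hreg : ∀ k r, y k * r ∈ Ideal.span (y '' {i | i < k}) →
      r ∈ Ideal.span (y '' {i | i < k}))
    (Z : Fin n → R) (hZ : ∑ i, Z i * θ i = 0) :
    ∃ A : Fin n → Fin n → R, (∀ i j, A i j = -A j i) ∧ ∀ i, Z i = ∑ j, A i j * θ j := by
  set z : Finset (Fin n) → R := fun I => ∑ i, if I = {i} then Z i else 0 with hz
  have hz1 : ∀ i, z {i} = Z i := fun i => by simp [hz]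
  have hz0 : ∀ I : Finset (Fin n), I.card ≠ 1 → z I = 0 := fun I hI =>
    Finset.sum_eq_zero fun i _ => if_neg fun h => hI (by rw [h, Finset.card_singleton])
  -- The relation is a 1-cycle. With nothing divided out (`k = 0`) it is the contraction of a
  -- 2-chain, whose values on pairs give the antisymmetric matrix.
  obtain ⟨v, -, hv⟩ := exact_mod θ y (fun k => by
    obtain ⟨a, ha⟩ := (Ideal.mem_span_range_iff_exists_fun).1 (hmem k)
    exact ⟨a, ha⟩) hreg n 0 1 (by simp) le_rfl z hz0 (fun I => by
      have : contr θ z I = 0 := by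
        by_cases hI : I.card = 0
        · rw [Finset.card_eq_zero.1 hI, contr, ← hZ]
          refine Finset.sum_congr rfl fun i _ => ?_
          simp [hz1, sgn, mul_comm]
        · exact contr_eq_zero θ (d := 0) hz0 I hI
      rw [this]
      exact Ideal.zero_mem _)
  refine ⟨fun i j => if i = j then 0 else sgn {i} j * v {j, i}, fun i j => ?_, fun i => ?_⟩
  · rcases lt_trichotomy i j with h | rfl | h
    · simp [sgn, h.ne, h.ne', Finset.filter_singleton, h, h.not_gt, Finset.pair_comm i j]
    · simp
    · simp [sgn, h.ne, h.ne', Finset.filter_singleton, h, h.not_gt, Finset.pair_comm i j]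
  · have h := hv {i}
    simp only [not_lt_zero, Set.ofPred_false, Set.image_empty, Ideal.span_empty, Ideal.mem_bot,
      sub_eq_zero, hz1] at h
    rw [h, contr]
    refine Finset.sum_congr rfl fun j _ => ?_
    simp only [Finset.mem_singleton, eq_comm (a := j)]
    split_ifs
    · simp
    · ring

end Koszul
end NambuPoisson

namespace NambuPoisson

/-! ### Vector fields -/

section VectorFields

variable {𝕜 A : Type*} [Field 𝕜] [CommRing A] [Algebra 𝕜 A] {n : ℕ}

/-- The divergence of the vector field `∑ Xᵢ ∂ᵢ`. -/
def divergence (δ : Fin n → Derivation 𝕜 A A) (X : Fin n → A) : A := ∑ i, δ i (X i)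

/-- The derivative of `f` along the vector field `∑ Xᵢ ∂ᵢ`. -/
def dirDeriv (δ : Fin n → Derivation 𝕜 A A) (X : Fin n → A) (f : A) : A := ∑ i, X i * δ i f

/-- The operator `X ↦ a f div X + b X(f)` on vector fields. -/
def twistedDiv (δ : Fin n → Derivation 𝕜 A A) (f : A) (a b : 𝕜) : (Fin n → A) →ₗ[𝕜] A where
  toFun X := a • (f * divergence δ X) + b • dirDeriv δ X f
  map_add' X Y := by
    simp only [divergence, dirDeriv, Pi.add_apply, map_add, Finset.sum_add_distrib, mul_add,
      add_mul, smul_add]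
    abel
  map_smul' c X := by
    simp only [divergence, dirDeriv, Pi.smul_apply, Derivation.map_smul, ← Finset.smul_sum,
      mul_smul_comm, smul_mul_assoc, RingHom.id_apply, smul_add, smul_comm c]

theorem twistedDiv_apply (δ : Fin n → Derivation 𝕜 A A) (f : A) (a b : 𝕜) (X : Fin n → A) :
    twistedDiv δ f a b X = a • (f * divergence δ X) + b • dirDeriv δ X f := rfl

theorem divergence_mul (δ : Fin n → Derivation 𝕜 A A) (u : A) (X : Fin n → A) :
    divergence δ (fun i => u * X i) = u * divergence δ X + dirDeriv δ X u := by
  simp [divergence, dirDeriv, Finset.sum_add_distrib, Finset.mul_sum]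

theorem dirDeriv_mul (δ : Fin n → Derivation 𝕜 A A) (u : A) (X : Fin n → A) (f : A) :
    dirDeriv δ (fun i => u * X i) f = u * dirDeriv δ X f := by
  simp [dirDeriv, Finset.mul_sum, mul_assoc]

/-- Multiplication by `f` raises the twist by one. -/
theorem twistedDiv_mul (δ : Fin n → Derivation 𝕜 A A) (f : A) (b : 𝕜) (X : Fin n → A) :
    twistedDiv δ f 1 b (fun i => f * X i) = f * twistedDiv δ f 1 (b + 1) X := by
  simp only [twistedDiv_apply, divergence_mul, dirDeriv_mul, mul_add, one_smul, add_smul,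
    mul_smul_comm]
  ring

/-- The Euler derivation `∑ wᵢ xᵢ ∂ᵢ`. -/
def eulerD (δ : Fin n → Derivation 𝕜 A A) (x : Fin n → A) (w : Fin n → ℤ) : Derivation 𝕜 A A :=
  ∑ i, (w i • x i) • δ i

theorem eulerD_apply (δ : Fin n → Derivation 𝕜 A A) (x : Fin n → A) (w : Fin n → ℤ) (g : A) :
    eulerD δ x w g = ∑ i, w i • (x i * δ i g) := by
  rw [eulerD, ← Derivation.coeFnAddMonoidHom_apply, map_sum, Finset.sum_apply]
  simp [mul_assoc]

theorem eulerD_eq_dirDeriv (δ : Fin n → Derivation 𝕜 A A) (x : Fin n → A) (w : Fin n → ℤ)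
    (g : A) : eulerD δ x w g = dirDeriv δ (fun i => w i • x i) g := by
  rw [eulerD_apply, dirDeriv]
  exact Finset.sum_congr rfl fun i _ => (smul_mul_assoc ..).symm

theorem eulerD_coord {δ : Fin n → Derivation 𝕜 A A} {x : Fin n → A}
    (hx : ∀ i j, δ i (x j) = if i = j then 1 else 0) (w : Fin n → ℤ) (j : Fin n) :
    eulerD δ x w (x j) = w j • x j := by
  rw [eulerD_apply, Finset.sum_eq_single j]
  · simp [hx]
  · intro i _ h; simp [hx, h]
  · simp

/-- The twisted divergence of a multiple of the Euler field. -/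
theorem twistedDiv_euler {δ : Fin n → Derivation 𝕜 A A} {x : Fin n → A}
    (hx : ∀ i j, δ i (x j) = if i = j then 1 else 0) (w : Fin n → ℤ) {f : A} {N : ℤ}
    (hf : eulerD δ x w f = N • f) (t : ℕ) (u : A) :
    twistedDiv δ f 1 (-(t : 𝕜)) (fun i => u * w i • x i) =
      f * (eulerD δ x w u + (∑ i, w i - t * N) • u) := by
  have hdiv : divergence δ (fun i => w i • x i) = ((∑ i, w i : ℤ) : A) := by
    simp [divergence, hx]
  rw [twistedDiv_apply, divergence_mul, dirDeriv_mul, ← eulerD_eq_dirDeriv,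
    ← eulerD_eq_dirDeriv, hf, hdiv, one_smul, neg_smul, Nat.cast_smul_eq_nsmul]
  simp only [zsmul_eq_mul, nsmul_eq_mul]
  push_cast
  ring

/-- Differentiation loses at most one order of vanishing; this controls Taylor remainders. -/
theorem derivation_mem_pow (D : Derivation 𝕜 A A) (I : Ideal A) (k : ℕ) {g : A}
    (hg : g ∈ I ^ (k + 1)) : D g ∈ I ^ k := by
  induction k generalizing g with
  | zero => simp
  | succ k ih =>
    rw [pow_succ] at hg
    induction hg using Submodule.mul_induction_on' with
    | mem_mul_mem a ha b hb =>
      rw [Derivation.leibniz, smul_eq_mul, smul_eq_mul]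
      refine add_mem (Ideal.mul_mem_right _ _ ha) ?_
      rw [mul_comm, pow_succ]
      exact Ideal.mul_mem_mul (ih ha) hb
    | add a _ b _ ha hb => rw [map_add]; exact add_mem ha hb

end VectorFields

/-! ### Germs and the Euler derivation -/

open MvPolynomial

section EulerRing

variable {𝕜 : Type} [Field 𝕜] {n : ℕ}

/-- The properties of the Euler derivation `E` of a ring of germs that are used below: `E + l` is
surjective for `l > 0`, and the kernel of `E` consists of the constants. -/
structure IsEulerRing (𝓕 : FunctionRing 𝕜 n) (w : Fin n → ℤ) (ev : 𝓕.carrier →ₐ[𝕜] 𝕜) :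
    Prop where
  pd_coord : ∀ i j, 𝓕.pd i (𝓕.coord j) = if i = j then 1 else 0
  ev_coord : ∀ i, ev (𝓕.coord i) = 0
  exists_euler : ∀ l : ℤ, 0 < l → ∀ g, ∃ u, eulerD 𝓕.pd 𝓕.coord w u + l • u = g
  const_of_euler : ∀ g, eulerD 𝓕.pd 𝓕.coord w g = 0 → g = algebraMap 𝕜 _ (ev g)

variable {𝓕 : FunctionRing 𝕜 n} {w : Fin n → ℤ} {ev : 𝓕.carrier →ₐ[𝕜] 𝕜}

namespace FunctionRing

variable (𝓕) in
/-- The ideal generated by the coordinates. -/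
def coordIdeal : Ideal 𝓕.carrier := Ideal.span (Set.range 𝓕.coord)

theorem ofPoly_X (i : Fin n) : 𝓕.ofPoly (X i) = 𝓕.coord i := by simp [ofPoly]

theorem ofPoly_C (c : 𝕜) : 𝓕.ofPoly (C c) = algebraMap 𝕜 _ c := by simp [ofPoly]

end FunctionRing

open FunctionRing

namespace IsEulerRing

theorem pd_ofPoly (h𝓕 : IsEulerRing 𝓕 w ev) (i : Fin n) (p : MvPolynomial (Fin n) 𝕜) :
    𝓕.pd i (𝓕.ofPoly p) = 𝓕.ofPoly (pderiv i p) := by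
  induction p using MvPolynomial.induction_on with
  | C a => simp
  | add p q hp hq => simp [hp, hq]
  | mul_X p j hp =>
    rw [map_mul, Derivation.leibniz, hp, ofPoly_X, h𝓕.pd_coord, Derivation.leibniz, pderiv_X]
    by_cases h : i = j
    · subst h; simp [ofPoly_X]
    · simp [h, ofPoly_X, Ne.symm h]

theorem ev_ofPoly (h𝓕 : IsEulerRing 𝓕 w ev) (p : MvPolynomial (Fin n) 𝕜) :
    ev (𝓕.ofPoly p) = coeff 0 p := by
  induction p using MvPolynomial.induction_on with
  | C a => simp
  | add p q hp hq => simp [hp, hq]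
  | mul_X p j hp => 
    rw [map_mul, map_mul, ofPoly_X, h𝓕.ev_coord, mul_zero, ← constantCoeff_eq, map_mul,
      constantCoeff_X, mul_zero]

theorem coordIdeal_le (h𝓕 : IsEulerRing 𝓕 w ev) : 𝓕.coordIdeal ≤ RingHom.ker ev := by
  rw [coordIdeal, Ideal.span_le]
  rintro _ ⟨i, rfl⟩
  exact h𝓕.ev_coord i

/-- Hadamard's lemma. -/
theorem exists_eq_const_add (h𝓕 : IsEulerRing 𝓕 w ev) (hw : ∀ i, 0 < w i) (g : 𝓕.carrier) :
    ∃ v : Fin n → 𝓕.carrier, g = algebraMap 𝕜 _ (ev g) + ∑ i, 𝓕.coord i * v i := by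
  -- Since `E (x_i v_i) = x_i (E + w_i) v_i`, this choice gives `E G = E g` for `G = ∑ w_i x_i v_i`,
  -- so `g - G` is constant.
  choose v hv using fun i => h𝓕.exists_euler (w i) (hw i) (𝓕.pd i g)
  set G := ∑ i, w i • (𝓕.coord i * v i) with hG
  have hE : eulerD 𝓕.pd 𝓕.coord w (g - G) = 0 := by
    rw [map_sub, hG, map_sum, eulerD_apply _ _ _ g, ← Finset.sum_sub_distrib]
    refine Finset.sum_eq_zero fun i _ => ?_
    rw [map_zsmul, Derivation.leibniz, eulerD_coord h𝓕.pd_coord, ← hv i, ← smul_sub]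
    simp only [smul_eq_mul, zsmul_eq_mul]
    ring
  have hev : ev G = 0 := by simp [hG, h𝓕.ev_coord]
  have := h𝓕.const_of_euler _ hE
  rw [map_sub, hev, sub_zero, sub_eq_iff_eq_add] at this
  refine ⟨fun i => w i • v i, this.trans ?_⟩
  simp only [hG, mul_smul_comm]

/-- Taylor's formula: every germ is a polynomial modulo any power of the coordinate ideal. -/
theorem exists_sub_ofPoly_mem (h𝓕 : IsEulerRing 𝓕 w ev) (hw : ∀ i, 0 < w i) (k : ℕ)
    (g : 𝓕.carrier) : ∃ p, g - 𝓕.ofPoly p ∈ 𝓕.coordIdeal ^ k := by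
  induction k generalizing g with
  | zero => exact ⟨0, by simp⟩
  | succ k ih =>
    obtain ⟨v, hv⟩ := h𝓕.exists_eq_const_add hw g
    choose p hp using fun i => ih (v i)
    refine ⟨C (ev g) + ∑ i, X i * p i, ?_⟩
    have : g - 𝓕.ofPoly (C (ev g) + ∑ i, X i * p i) =
        ∑ i, 𝓕.coord i * (v i - 𝓕.ofPoly (p i)) := by
      rw [map_add, ofPoly_C, ← sub_sub, sub_eq_iff_eq_add'.2 hv]
      simp [ofPoly_X, mul_sub]
    rw [this]
    refine sum_mem fun i _ => ?_
    rw [pow_succ']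
    exact Ideal.mul_mem_mul (Ideal.subset_span ⟨i, rfl⟩) (hp i)

/-- Induction by differentiation: a partial derivative costs one power of the ideal and, in
characteristic zero, multiplies the relevant coefficient by a nonzero integer. -/
theorem coeff_eq_zero_of_ofPoly_mem [CharZero 𝕜] (h𝓕 : IsEulerRing 𝓕 w ev) (k : ℕ)
    (p : MvPolynomial (Fin n) 𝕜) (hp : 𝓕.ofPoly p ∈ 𝓕.coordIdeal ^ k) (m : Fin n →₀ ℕ)
    (hm : m.degree < k) : coeff m p = 0 := by
  induction k generalizing p m with
  | zero => simp at hm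
  | succ k ih =>
    by_cases h0 : m = 0
    · subst h0
      rw [← h𝓕.ev_ofPoly]
      exact h𝓕.coordIdeal_le (Ideal.pow_le_self k.succ_ne_zero hp)
    · obtain ⟨i, hi⟩ : ∃ i, m i ≠ 0 := by
        by_contra! h
        exact h0 (Finsupp.ext h)
      obtain ⟨m', rfl⟩ : ∃ m', m = m' + Finsupp.single i 1 :=
        ⟨m - Finsupp.single i 1, (tsub_add_cancel_of_le (by
          simpa [Nat.one_le_iff_ne_zero] using hi)).symm⟩
      have h1 := ih (pderiv i p) (by
        rw [← h𝓕.pd_ofPoly]; exact derivation_mem_pow _ _ _ hp) m' (by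
        rw [map_add, Finsupp.degree_single] at hm; omega)
      rw [coeff_pderiv] at h1
      refine (mul_eq_zero.1 h1).resolve_right ?_
      exact Nat.cast_add_one_ne_zero _

/-- Up to a quasihomogeneous polynomial of degree `-l`, every germ is in the image of `E + l`. -/
theorem exists_euler_add_poly [CharZero 𝕜] (h𝓕 : IsEulerRing 𝓕 w ev) (hw : ∀ i, 0 < w i)
    (k : ℕ) (l : ℤ) (hl : -(k : ℤ) < l) (g : 𝓕.carrier) :
    ∃ (u : 𝓕.carrier) (p : MvPolynomial (Fin n) 𝕜), p.IsWeightedHomogeneous w (-l) ∧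
      g = eulerD 𝓕.pd 𝓕.coord w u + l • u + 𝓕.ofPoly p := by
  -- As `(E + l) (x_i u) = x_i (E + l + w_i) u`, splitting off a coordinate raises `l` by at least
  -- one, until `l > 0` and `E + l` is onto.
  induction k generalizing l g with
  | zero =>
    obtain ⟨u, hu⟩ := h𝓕.exists_euler l (by simpa using hl) g
    exact ⟨u, 0, isWeightedHomogeneous_zero _ _ _, by rw [hu, map_zero, add_zero]⟩
  | succ k ih =>
    obtain ⟨v, hv⟩ := h𝓕.exists_eq_const_add hw g
    have hl' : ∀ i, -(k : ℤ) < l + w i := fun i => by have := hw i; push_cast at hl; omega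
    choose u p hp hup using fun i => ih (l + w i) (hl' i) (v i)
    obtain ⟨u₀, p₀, hp₀, hc⟩ : ∃ (u₀ : 𝓕.carrier) (p₀ : MvPolynomial (Fin n) 𝕜),
        p₀.IsWeightedHomogeneous w (-l) ∧ algebraMap 𝕜 _ (ev g) =
          eulerD 𝓕.pd 𝓕.coord w u₀ + l • u₀ + 𝓕.ofPoly p₀ := by
      -- A constant `c` is the image of `c / l`, unless `l = 0`, when it is itself quasihomogeneous
      -- of degree `-l`.
      by_cases h : l = 0
      · subst h
        exact ⟨0, C (ev g), isWeightedHomogeneous_C _ _, by simp⟩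
      · refine ⟨algebraMap 𝕜 _ ((l : 𝕜)⁻¹ * ev g), 0, isWeightedHomogeneous_zero _ _ _, ?_⟩
        rw [Derivation.map_algebraMap, zero_add, map_zero, add_zero, ← map_zsmul, zsmul_eq_mul,
          mul_inv_cancel_left₀ (by exact_mod_cast h)]
    refine ⟨u₀ + ∑ i, 𝓕.coord i * u i, p₀ + ∑ i, X i * p i, ?_, ?_⟩
    · refine hp₀.add (IsWeightedHomogeneous.sum _ _ _ fun i _ => ?_)
      have := (isWeightedHomogeneous_X 𝕜 w i).mul (hp i)
      rwa [show w i + -(l + w i) = -l by ring] at this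
    · conv_lhs => rw [hv, hc]
      have : ∑ i, 𝓕.coord i * v i = ∑ i, (eulerD 𝓕.pd 𝓕.coord w (𝓕.coord i * u i) +
          l • (𝓕.coord i * u i) + 𝓕.ofPoly (X i * p i)) := by
        refine Finset.sum_congr rfl fun i _ => ?_
        conv_lhs => rw [hup i]
        rw [Derivation.leibniz, eulerD_coord h𝓕.pd_coord, map_mul, ofPoly_X]
        simp only [smul_eq_mul, zsmul_eq_mul]
        push_cast
        ring
      rw [this, Finset.sum_add_distrib, Finset.sum_add_distrib, ← map_sum, ← map_sum,
        ← Finset.smul_sum, map_add, map_add, smul_add]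
      abel

end IsEulerRing

end EulerRing

end NambuPoisson

namespace NambuPoisson

open MvPolynomial FunctionRing

/-! ### Quasihomogeneous components -/

section Components

variable {𝕜 : Type} [Field 𝕜] {n : ℕ} {w : Fin n → ℤ}

local notation "𝐏" => MvPolynomial (Fin n) 𝕜

theorem component_mul {h : 𝐏} {e : ℤ} (hh : h.IsWeightedHomogeneous w e) (d : ℤ) (p : 𝐏) :
    weightedHomogeneousComponent w d (p * h) = weightedHomogeneousComponent w (d - e) p * h := by
  induction p using MvPolynomial.monomial_add_induction_on with
  | C a =>
    have h1 := isWeightedHomogeneous_C w a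
    have h2 := h1.mul hh
    rw [weightedHomogeneousComponent_of_mem h1, weightedHomogeneousComponent_of_mem h2]
    split_ifs <;> first | rfl | omega
  | monomial_add m b p _ _ ihp =>
    have h1 := isWeightedHomogeneous_monomial w m b rfl
    have h2 := h1.mul hh
    rw [add_mul, map_add, map_add, add_mul, ihp, weightedHomogeneousComponent_of_mem h1,
      weightedHomogeneousComponent_of_mem h2]
    split_ifs <;> first | rfl | omega

theorem component_pderiv (d : ℤ) (i : Fin n) (p : 𝐏) :
    weightedHomogeneousComponent w d (pderiv i p) =
      pderiv i (weightedHomogeneousComponent w (d + w i) p) := by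
  induction p using MvPolynomial.monomial_add_induction_on with
  | C a =>
    rw [weightedHomogeneousComponent_of_mem (isWeightedHomogeneous_C w a)]
    split_ifs <;> simp
  | monomial_add m b p _ _ ihp =>
    have h1 := isWeightedHomogeneous_monomial w m b rfl
    have h2 : (pderiv i (monomial m b)).IsWeightedHomogeneous w (Finsupp.weight w m - w i) :=
      h1.pderiv (sub_add_cancel _ _)
    rw [map_add, map_add, map_add, map_add, ihp, weightedHomogeneousComponent_of_mem h1,
      weightedHomogeneousComponent_of_mem h2]
    split_ifs <;> first | rfl | omega

theorem exists_eq_sum_component (p : 𝐏) :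
    ∃ S : Finset ℤ, p = ∑ d ∈ S, weightedHomogeneousComponent w d p := by
  refine ⟨(weightedHomogeneousComponent_finsupp (w := w) p).toFinset, ?_⟩
  conv_lhs => rw [← finsum_weightedHomogeneousComponent w p]
  rw [finsum_eq_sum _ (weightedHomogeneousComponent_finsupp p)]

/-- Weights are at least one, so the weighted degree of a monomial is at least its ordinary degree.
-/
theorem component_eq_zero_of_coeff (hw : ∀ i, 0 < w i) {k : ℕ} {p : 𝐏}
    (hp : ∀ m : Fin n →₀ ℕ, m.degree < k → coeff m p = 0) {d : ℤ} (hd : d < k) :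
    weightedHomogeneousComponent w d p = 0 := by
  refine weightedHomogeneousComponent_eq_zero' _ _ fun m hm h => ?_
  refine (mem_support_iff.1 hm) (hp m ?_)
  have : (m.degree : ℤ) ≤ Finsupp.weight w m := by
    rw [Finsupp.weight_apply, Finsupp.sum_fintype _ _ (by simp), Finsupp.degree_eq_sum]
    push_cast
    refine Finset.sum_le_sum fun i _ => ?_
    rw [nsmul_eq_mul]
    exact le_mul_of_one_le_right (by positivity) (hw i)
  omega

theorem component_divergence (d : ℤ) (Y : Fin n → 𝐏) :
    weightedHomogeneousComponent w d (divergence (pderiv (R := 𝕜)) Y) =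
      divergence pderiv fun i => weightedHomogeneousComponent w (d + w i) (Y i) := by
  simp only [divergence, map_sum, component_pderiv]

theorem component_dirDeriv {f : 𝐏} {N : ℤ} (hf : f.IsWeightedHomogeneous w N) (d : ℤ)
    (Y : Fin n → 𝐏) : weightedHomogeneousComponent w d (dirDeriv pderiv Y f) =
      dirDeriv pderiv (fun i => weightedHomogeneousComponent w (d - N + w i) (Y i)) f := by
  simp only [dirDeriv, map_sum]
  refine Finset.sum_congr rfl fun i _ => ?_
  rw [component_mul (hf.pderiv (sub_add_cancel N (w i)))]
  congr 3
  ring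

/-- The operator is graded, so homogeneous equations have homogeneous solutions once they have any.
The case `a = 0`, `b = 1` treats membership in the Jacobian ideal on the same footing. -/
theorem component_twistedDiv {f : 𝐏} {N : ℤ} (hf : f.IsWeightedHomogeneous w N) (a b : 𝕜) (d : ℤ)
    (Y : Fin n → 𝐏) : weightedHomogeneousComponent w d (twistedDiv pderiv f a b Y) =
      twistedDiv pderiv f a b
        fun i => weightedHomogeneousComponent w (d - N + w i) (Y i) := by
  rw [twistedDiv_apply, twistedDiv_apply, map_add, map_smul, map_smul, component_dirDeriv hf,
    mul_comm f, component_mul hf, component_divergence, mul_comm f]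

/-- Euler's identity. -/
theorem eulerD_eq {p : 𝐏} {d : ℤ} (hp : p.IsWeightedHomogeneous w d) :
    eulerD (pderiv (R := 𝕜)) X w p = d • p := by
  rw [← mem_weightedHomogeneousSubmodule, weightedHomogeneousSubmodule_eq_finsupp_supported,
    AddMonoidAlgebra.supported_eq_span_single] at hp
  refine Submodule.span_induction ?_ ?_ (fun p q _ _ hp hq => ?_) (fun r p _ h => ?_) hp
  · rintro _ ⟨m, hm, rfl⟩
    have hm : Finsupp.weight w m = d := hm
    change eulerD pderiv X w (monomial m 1) = d • monomial m (1 : 𝕜)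
    rw [eulerD_apply, ← hm, Finsupp.weight_apply,
      Finsupp.sum_fintype _ _ (by simp), Finset.sum_smul]
    refine Finset.sum_congr rfl fun i _ => ?_
    rw [X_mul_pderiv_monomial]
    simp only [nsmul_eq_mul, zsmul_eq_mul]
    push_cast
    ring
  · simp
  · rw [map_add, hp, hq, smul_add]
  · rw [Derivation.map_smul, h, smul_comm]

theorem component_mem_monomialSpan (𝓑 : Finset (Fin n →₀ ℕ)) (d : ℤ) {p : 𝐏}
    (hp : p ∈ monomialSpan 𝕜 𝓑) :
    weightedHomogeneousComponent w d p ∈ monomialSpan 𝕜 (ofDegree w 𝓑 d) := by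
  induction hp using Submodule.span_induction with
  | mem p hp =>
    obtain ⟨m, hm, rfl⟩ := hp
    rw [weightedHomogeneousComponent_of_mem (isWeightedHomogeneous_monomial w m 1 rfl)]
    split_ifs with h
    · exact Submodule.subset_span ⟨m, by simpa [ofDegree, h] using hm, rfl⟩
    · exact zero_mem _
  | zero => rw [map_zero]; exact zero_mem _
  | add p q _ _ hp hq => rw [map_add]; exact add_mem hp hq
  | smul c p _ hp => rw [map_smul]; exact Submodule.smul_mem _ c hp

theorem monomialSpan_mono {𝓑 𝓑' : Finset (Fin n →₀ ℕ)} (h : 𝓑 ⊆ 𝓑') :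
    monomialSpan 𝕜 𝓑 ≤ monomialSpan 𝕜 𝓑' :=
  Submodule.span_mono (Set.image_mono (by exact_mod_cast h))

theorem ofDegree_subset (𝓑 : Finset (Fin n →₀ ℕ)) (d : ℤ) : ofDegree w 𝓑 d ⊆ 𝓑 :=
  Finset.filter_subset _ _

theorem isWeightedHomogeneous_of_mem_monomialSpan {𝓑 : Finset (Fin n →₀ ℕ)} {d : ℤ} {p : 𝐏}
    (hp : p ∈ monomialSpan 𝕜 (ofDegree w 𝓑 d)) : p.IsWeightedHomogeneous w d := by
  rw [← mem_weightedHomogeneousSubmodule]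
  refine (Submodule.span_le.2 ?_ : monomialSpan 𝕜 (ofDegree w 𝓑 d) ≤ _) hp
  rintro _ ⟨m, hm, rfl⟩
  exact isWeightedHomogeneous_monomial w m 1 (Finset.mem_filter.1 hm).2

/-- A quasihomogeneous value of the twisted divergence is attained on a quasihomogeneous vector
field. -/
theorem exists_homogeneous_of_twistedDiv_eq {f : 𝐏} {N : ℤ} (hf : f.IsWeightedHomogeneous w N)
    {a b : 𝕜} {d : ℤ} {p : 𝐏} (hp : p.IsWeightedHomogeneous w d) {Y : Fin n → 𝐏}
    (hY : p = twistedDiv pderiv f a b Y) : ∃ Y' : Fin n → 𝐏,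
      (∀ i, (Y' i).IsWeightedHomogeneous w (d - N + w i)) ∧ p = twistedDiv pderiv f a b Y' :=
  ⟨_, fun i => weightedHomogeneousComponent_isWeightedHomogeneous _ (Y i), by
    rw [← component_twistedDiv hf, ← hY, weightedHomogeneousComponent_eq_self hp]⟩

theorem isWeightedHomogeneous_divergence {Y : Fin n → 𝐏} {d : ℤ}
    (hY : ∀ i, (Y i).IsWeightedHomogeneous w (d + w i)) :
    (divergence (pderiv (R := 𝕜)) Y).IsWeightedHomogeneous w d :=
  IsWeightedHomogeneous.sum _ _ _ fun i _ => (hY i).pderiv rfl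

theorem isWeightedHomogeneous_smul {p : 𝐏} {d : ℤ} (hp : p.IsWeightedHomogeneous w d) (c : 𝕜) :
    (c • p).IsWeightedHomogeneous w d :=
  (weightedHomogeneousSubmodule 𝕜 w d).smul_mem c hp

end Components

/-! ### Comparison of germs with polynomials -/

section Transfer

variable {𝕜 : Type} [Field 𝕜] {n : ℕ} {w : Fin n → ℤ}
  {𝓕 : FunctionRing 𝕜 n} {ev : 𝓕.carrier →ₐ[𝕜] 𝕜}

theorem IsEulerRing.twistedDiv_ofPoly (h𝓕 : IsEulerRing 𝓕 w ev) (f : MvPolynomial (Fin n) 𝕜)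
    (a b : 𝕜) (Y : Fin n → MvPolynomial (Fin n) 𝕜) :
    twistedDiv 𝓕.pd (𝓕.ofPoly f) a b (fun i => 𝓕.ofPoly (Y i)) =
      𝓕.ofPoly (twistedDiv pderiv f a b Y) := by
  simp [twistedDiv_apply, divergence, dirDeriv, h𝓕.pd_ofPoly]

theorem twistedDiv_mem_pow (δ : Fin n → Derivation 𝕜 𝓕.carrier 𝓕.carrier) (f : 𝓕.carrier)
    (a b : 𝕜) (I : Ideal 𝓕.carrier) (k : ℕ) {X : Fin n → 𝓕.carrier}
    (hX : ∀ i, X i ∈ I ^ (k + 1)) : twistedDiv δ f a b X ∈ I ^ k := by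
  rw [twistedDiv_apply]
  refine add_mem (Submodule.smul_of_tower_mem _ _ (Ideal.mul_mem_left _ _ (sum_mem fun i _ =>
    derivation_mem_pow _ _ _ (hX i)))) (Submodule.smul_of_tower_mem _ _ (sum_mem fun i _ =>
    Ideal.mul_mem_right _ _ (Ideal.pow_le_pow_right k.le_succ (hX i))))

/-- A polynomial which is a twisted divergence of a germ of vector field is a twisted divergence
of a polynomial vector field. -/
theorem IsEulerRing.exists_poly_of_twistedDiv_eq [CharZero 𝕜] (h𝓕 : IsEulerRing 𝓕 w ev)
    (hw : ∀ i, 0 < w i) {f : MvPolynomial (Fin n) 𝕜} {N : ℤ} (hf : f.IsWeightedHomogeneous w N)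
    {a b : 𝕜} {p : MvPolynomial (Fin n) 𝕜} {Z : Fin n → 𝓕.carrier}
    (hZ : 𝓕.ofPoly p = twistedDiv 𝓕.pd (𝓕.ofPoly f) a b Z) :
    ∃ Y : Fin n → MvPolynomial (Fin n) 𝕜, p = twistedDiv pderiv f a b Y := by
  obtain ⟨S, hS⟩ := exists_eq_sum_component (w := w) p
  obtain ⟨k, hk⟩ : ∃ k : ℕ, ∀ d ∈ S, d < (k : ℤ) := by
    obtain ⟨B, hB⟩ := S.bddAbove
    exact ⟨(B + 1).toNat, fun d hd => by have := hB hd; omega⟩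
  -- `Y` is a Taylor polynomial of `Z`. The twisted divergence loses one order, so the error lies in
  -- the `k`-th power of the coordinate ideal and is invisible in weighted degrees below `k`, where
  -- all of `p` lives.
  choose Y hY using fun i => h𝓕.exists_sub_ofPoly_mem hw (k + 1) (Z i)
  have hmem : 𝓕.ofPoly (p - twistedDiv pderiv f a b Y) ∈ 𝓕.coordIdeal ^ k := by
    rw [map_sub, hZ, ← h𝓕.twistedDiv_ofPoly, ← map_sub]
    exact twistedDiv_mem_pow _ _ _ _ _ _ hY
  have hcoef := h𝓕.coeff_eq_zero_of_ofPoly_mem k _ hmem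
  have hmem' : p ∈ LinearMap.range (twistedDiv (pderiv (R := 𝕜)) f a b) := by
    rw [hS]
    refine sum_mem fun d hd => ⟨_, (component_twistedDiv hf a b d Y).symm.trans ?_⟩
    have := component_eq_zero_of_coeff hw hcoef (hk d hd)
    rw [map_sub, sub_eq_zero] at this
    exact this.symm
  obtain ⟨Y', hY'⟩ := hmem'
  exact ⟨Y', hY'.symm⟩

theorem mem_span_range_iff_dirDeriv {A : Type*} [CommRing A] [Algebra 𝕜 A]
    (δ : Fin n → Derivation 𝕜 A A) (f g : A) :
    g ∈ Ideal.span (Set.range fun i => δ i f) ↔ ∃ X, g = dirDeriv δ X f := by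
  rw [Ideal.mem_span_range_iff_exists_fun]
  exact exists_congr fun X => eq_comm

theorem twistedDiv_zero_one {A : Type*} [CommRing A] [Algebra 𝕜 A]
    (δ : Fin n → Derivation 𝕜 A A) (f : A) (X : Fin n → A) :
    twistedDiv δ f (0 : 𝕜) 1 X = dirDeriv δ X f := by
  simp [twistedDiv_apply]

variable {f : MvPolynomial (Fin n) 𝕜} {N : ℤ} {𝓑 : Finset (Fin n →₀ ℕ)}

/-- The class in `Q_f` of a polynomial. -/
noncomputable def polyClass (𝓕 : FunctionRing 𝕜 n) (f : 𝓕.carrier) :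
    MvPolynomial (Fin n) 𝕜 →ₗ[𝕜] 𝓕.MilnorAlgebra f :=
  (Ideal.Quotient.mkₐ 𝕜 (𝓕.jacobianIdeal f)).toLinearMap ∘ₗ 𝓕.ofPoly.toLinearMap

theorem map_monomialSpan (𝓕 : FunctionRing 𝕜 n) (f : 𝓕.carrier) (𝓑 : Finset (Fin n →₀ ℕ)) :
    (monomialSpan 𝕜 𝓑).map (polyClass 𝓕 f) =
      Submodule.span 𝕜 (𝓕.monomialClass f '' 𝓑) := by
  rw [monomialSpan, Submodule.map_span, Set.image_image]
  rfl

/-- Every germ is a combination of basis monomials modulo the Jacobian ideal. -/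
theorem exists_basis_add_dirDeriv (h𝓑 : 𝓕.IsMonomialBasis (𝓕.ofPoly f) 𝓑) (g : 𝓕.carrier) :
    ∃ b ∈ monomialSpan 𝕜 𝓑, ∃ Z, g = 𝓕.ofPoly b + dirDeriv 𝓕.pd Z (𝓕.ofPoly f) := by
  have h : Ideal.Quotient.mk (𝓕.jacobianIdeal (𝓕.ofPoly f)) g ∈
      (monomialSpan 𝕜 𝓑).map (polyClass 𝓕 (𝓕.ofPoly f)) := by
    rw [map_monomialSpan, h𝓑.2]
    trivial
  obtain ⟨b, hb, hbg⟩ := h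
  have := Ideal.Quotient.eq.1 hbg.symm
  obtain ⟨Z, hZ⟩ := (mem_span_range_iff_dirDeriv _ _ _).1 this
  exact ⟨b, hb, Z, sub_eq_iff_eq_add'.1 hZ⟩

/-- The basis monomials are independent modulo the Jacobian ideal. -/
theorem eq_zero_of_mem_monomialSpan (h𝓑 : 𝓕.IsMonomialBasis (𝓕.ofPoly f) 𝓑)
    {b : MvPolynomial (Fin n) 𝕜} (hb : b ∈ monomialSpan 𝕜 𝓑) {Z : Fin n → 𝓕.carrier}
    (hZ : 𝓕.ofPoly b = dirDeriv 𝓕.pd Z (𝓕.ofPoly f)) : b = 0 := by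
  have h0 : polyClass 𝓕 (𝓕.ofPoly f) b = 0 :=
    Ideal.Quotient.eq_zero_iff_mem.2 ((mem_span_range_iff_dirDeriv _ _ _).2 ⟨Z, hZ⟩)
  rw [monomialSpan, Finsupp.mem_span_image_iff_linearCombination] at hb
  obtain ⟨c, hc, rfl⟩ := hb
  have hli : LinearIndepOn 𝕜 (𝓕.monomialClass (𝓕.ofPoly f)) (𝓑 : Set (Fin n →₀ ℕ)) := h𝓑.1
  rw [linearIndepOn_iff] at hli
  rw [hli c hc, map_zero]
  rw [← h0, Finsupp.apply_linearCombination]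
  rfl

/-- The decomposition modulo the Jacobian ideal is known for germs; the case `a = 0`, `b = 1` of the
transfer makes it polynomial, and the component of degree `d` is extracted. -/
theorem IsEulerRing.exists_poly_basis_add [CharZero 𝕜] (h𝓕 : IsEulerRing 𝓕 w ev)
    (hw : ∀ i, 0 < w i) (hf : f.IsWeightedHomogeneous w N)
    (h𝓑 : 𝓕.IsMonomialBasis (𝓕.ofPoly f) 𝓑) {d : ℤ} {p : MvPolynomial (Fin n) 𝕜}
    (hp : p.IsWeightedHomogeneous w d) : ∃ b ∈ monomialSpan 𝕜 (ofDegree w 𝓑 d),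
      ∃ Y : Fin n → MvPolynomial (Fin n) 𝕜, (∀ i, (Y i).IsWeightedHomogeneous w (d - N + w i)) ∧
        p = b + dirDeriv pderiv Y f := by
  obtain ⟨b, hb, Z, hZ⟩ := exists_basis_add_dirDeriv h𝓑 (𝓕.ofPoly p)
  obtain ⟨Y, hY⟩ := h𝓕.exists_poly_of_twistedDiv_eq hw hf (p := p - b) (Z := Z) (a := 0) (b := 1)
    (by rw [map_sub, hZ, twistedDiv_zero_one, add_sub_cancel_left])
  rw [twistedDiv_zero_one] at hY
  refine ⟨_, component_mem_monomialSpan 𝓑 d hb, _, fun i =>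
    weightedHomogeneousComponent_isWeightedHomogeneous _ (Y i), ?_⟩
  rw [← component_dirDeriv hf, ← hY, ← map_add, add_sub_cancel,
    weightedHomogeneousComponent_eq_self hp]

end Transfer

end NambuPoisson

namespace NambuPoisson

open MvPolynomial FunctionRing

/-! ### Top twisted cohomology of quasihomogeneous polynomials -/

section Polynomial

variable {𝕜 : Type} [Field 𝕜] {n : ℕ} {w : Fin n → ℤ}

local notation "𝐏" => MvPolynomial (Fin n) 𝕜

theorem pderiv_pderiv_comm (i j : Fin n) (p : 𝐏) :
    pderiv i (pderiv j p) = pderiv j (pderiv i p) := by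
  have h : ⁅(pderiv i : Derivation 𝕜 𝐏 𝐏), (pderiv j : Derivation 𝕜 𝐏 𝐏)⁆ = 0 := by
    refine derivation_ext fun k => ?_
    rw [Derivation.commutator_apply, pderiv_X, pderiv_X]
    simp [Pi.single_apply, apply_ite]
  have := congrArg (fun D => D p) h
  rwa [Derivation.commutator_apply, Derivation.zero_apply, sub_eq_zero] at this

/-- Membership in a monomial ideal is tested on the support, and for `i ≠ k` divisibility by `X i ^
M` is unaffected by a factor `X k ^ M`. -/
theorem X_pow_regular (M : ℕ) (k : Fin n) (r : 𝐏)
    (h : X k ^ M * r ∈ Ideal.span ((fun i : Fin n => (X i ^ M : 𝐏)) '' {i | i < k})) :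
    r ∈ Ideal.span ((fun i : Fin n => (X i ^ M : 𝐏)) '' {i | i < k}) := by
  have himg : (fun i : Fin n => (X i ^ M : 𝐏)) '' {i | i < k} =
      (fun s => monomial s (1 : 𝕜)) '' ((fun i => Finsupp.single i M) '' {i | i < k}) := by
    simp only [Set.image_image, X_pow_eq_monomial]
  rw [himg, mem_ideal_span_monomial_image] at h ⊢
  intro m hm
  obtain ⟨_, ⟨i, hi, rfl⟩, hle⟩ := h (Finsupp.single k M + m) (by
    rw [mem_support_iff, X_pow_eq_monomial, coeff_monomial_mul, one_mul]
    exact mem_support_iff.1 hm)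
  refine ⟨_, ⟨i, hi, rfl⟩, ?_⟩
  rw [Finsupp.single_le_iff] at hle ⊢
  have hik : k ≠ i := (ne_of_lt hi).symm
  simpa [Finsupp.single_apply, hik] using hle

variable {f : MvPolynomial (Fin n) 𝕜} {N : ℤ} {𝓑 : Finset (Fin n →₀ ℕ)}

/-- For `M` above all weights of `𝓑`, no basis monomial has the degree of `X k ^ M`, so the Jacobian
ideal is everything in that degree. -/
theorem exists_X_pow_mem (hw : ∀ i, 0 < w i)
    (hbas : ∀ (d : ℤ) (p : 𝐏), p.IsWeightedHomogeneous w d →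
      ∃ b ∈ monomialSpan 𝕜 (ofDegree w 𝓑 d), ∃ Y : Fin n → 𝐏,
        (∀ i, (Y i).IsWeightedHomogeneous w (d - N + w i)) ∧ p = b + dirDeriv pderiv Y f) :
    ∃ M : ℕ, ∀ k, (X k ^ M : 𝐏) ∈ Ideal.span (Set.range fun i => pderiv i f) := by
  refine ⟨(∑ m ∈ 𝓑, (Finsupp.weight w m).natAbs) + 1, fun k => ?_⟩
  set M := (∑ m ∈ 𝓑, (Finsupp.weight w m).natAbs) + 1 with hM
  obtain ⟨b, hb, Y, -, hY⟩ := hbas _ _ ((isWeightedHomogeneous_X 𝕜 w k).pow M)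
  have hempty : ofDegree w 𝓑 (M • w k) = ∅ := by
    refine Finset.filter_eq_empty_iff.2 fun m hm h => ?_
    have h1 : (Finsupp.weight w m).natAbs ≤ ∑ m ∈ 𝓑, (Finsupp.weight w m).natAbs :=
      Finset.single_le_sum (f := fun m => (Finsupp.weight w m).natAbs) (fun _ _ => Nat.zero_le _) hm
    have h2 : (M : ℤ) ≤ M • w k := by
      rw [nsmul_eq_mul]; exact le_mul_of_one_le_right (by positivity) (hw k)
    omega
  rw [hempty, monomialSpan, Finset.coe_empty, Set.image_empty, Submodule.span_empty,
    Submodule.mem_bot] at hb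
  rw [hb, zero_add] at hY
  exact (mem_span_range_iff_dirDeriv _ _ _).2 ⟨Y, hY⟩

theorem sum_sum_eq_zero_of_antisymm [CharZero 𝕜] {T : Fin n → Fin n → 𝐏}
    (hT : ∀ i j, T i j = -T j i) : ∑ i, ∑ j, T i j = 0 := by
  have h : ∑ i, ∑ j, T i j = -∑ i, ∑ j, T i j := by
    conv_lhs => rw [Finset.sum_comm]
    simp only [← Finset.sum_neg_distrib]
    exact Finset.sum_congr rfl fun j _ => Finset.sum_congr rfl fun i _ => hT i j
  have h2 : (2 : 𝐏) * ∑ i, ∑ j, T i j = 0 := by linear_combination h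
  exact (mul_eq_zero.1 h2).resolve_left two_ne_zero

/-- A vector field annihilating `f` has divergence `V(f)` with `V` divergence free. -/
theorem exists_divFree_of_dirDeriv_eq_zero [CharZero 𝕜]
    (hX : ∃ M : ℕ, ∀ k, (X k ^ M : 𝐏) ∈ Ideal.span (Set.range fun i => pderiv i f))
    {Z : Fin n → 𝐏} (hZ : dirDeriv pderiv Z f = 0) :
    ∃ V : Fin n → 𝐏, divergence (pderiv (R := 𝕜)) V = 0 ∧
      divergence (pderiv (R := 𝕜)) Z = dirDeriv pderiv V f := by
  obtain ⟨M, hM⟩ := hX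
  -- In `div Z` the symmetric second derivatives of `f` cancel against the antisymmetric `A`,
  -- leaving `V(f)` with `V_j = ∑ ∂_i A_ij`; `div V = 0` for the same reason.
  obtain ⟨A, hA, hZA⟩ := Koszul.exists_antisymm_of_sum_mul_eq_zero (fun i => pderiv i f)
    (fun i => (X i ^ M : 𝐏)) hM (X_pow_regular M) Z hZ
  refine ⟨fun j => ∑ i, pderiv i (A i j), ?_, ?_⟩
  · simp only [divergence, map_sum]
    refine sum_sum_eq_zero_of_antisymm fun i j => ?_
    rw [hA, map_neg, map_neg, pderiv_pderiv_comm]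
  · simp only [divergence, dirDeriv, Finset.sum_mul]
    rw [Finset.sum_comm (γ := Fin n), ← sub_eq_zero, ← Finset.sum_sub_distrib]
    refine Eq.trans ?_ (sum_sum_eq_zero_of_antisymm
      (T := fun i j => A i j * pderiv i (pderiv j f)) fun i j => ?_)
    · refine Finset.sum_congr rfl fun i _ => ?_
      rw [hZA, map_sum, ← Finset.sum_sub_distrib]
      refine Finset.sum_congr rfl fun j _ => ?_
      rw [Derivation.leibniz, smul_eq_mul, smul_eq_mul]
      ring
    · rw [hA, pderiv_pderiv_comm, neg_mul]

/-- Make `Y` homogeneous and put `u = G - div Y`. The equation says `f u = -t Y(f)`, so `Z = u E + t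
N Y` kills `f`; and since `u` has degree `t N - ∑ w_i`, the divergence of `Z` is exactly `t N G`. -/
theorem exists_divFree_of_mul_eq [CharZero 𝕜] (hN : N ≠ 0) (hf : f.IsWeightedHomogeneous w N)
    (hX : ∃ M : ℕ, ∀ k, (X k ^ M : 𝐏) ∈ Ideal.span (Set.range fun i => pderiv i f))
    {t : ℕ} (ht : t ≠ 0) {G : 𝐏} (hG : G.IsWeightedHomogeneous w (t * N - ∑ i, w i))
    {Y : Fin n → 𝐏} (hY : f * G = twistedDiv pderiv f 1 (-(t : 𝕜)) Y) :
    ∃ V : Fin n → 𝐏, divergence (pderiv (R := 𝕜)) V = 0 ∧ G = dirDeriv pderiv V f := by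
  obtain ⟨Y, hYh, hY⟩ := exists_homogeneous_of_twistedDiv_eq hf (hf.mul hG) hY
  set e : ℤ := t * N - ∑ i, w i with he
  have hdiv := isWeightedHomogeneous_divergence (d := e) (Y := Y) fun i => by
    have := hYh i
    rwa [add_sub_cancel_left] at this
  have hu := eulerD_eq (hG.sub hdiv)
  set u := G - divergence (pderiv (R := 𝕜)) Y with hu'
  have hc : ((t * N : ℤ) : 𝕜) ≠ 0 := by
    exact_mod_cast mul_ne_zero (Int.natCast_ne_zero.2 ht) hN
  rw [twistedDiv_apply, one_smul, neg_smul, Nat.cast_smul_eq_nsmul, nsmul_eq_mul] at hY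
  set Z : Fin n → 𝐏 := (fun i => u * w i • X i) + ((t * N : ℤ) : 𝕜) • Y with hZ
  have hadd : ∀ g : 𝐏, dirDeriv pderiv Z g =
      u * eulerD pderiv X w g + (t * N : ℤ) * dirDeriv pderiv Y g := fun g => by
    rw [eulerD_eq_dirDeriv, ← dirDeriv_mul]
    simp only [dirDeriv, hZ, Pi.add_apply, add_mul, Finset.sum_add_distrib, Pi.smul_apply]
    simp only [Int.cast_smul_eq_zsmul, zsmul_eq_mul, Finset.mul_sum, mul_assoc]
  have hdivZ : divergence (pderiv (R := 𝕜)) Z = (t * N : ℤ) * G := by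
    have h1 : divergence (pderiv (R := 𝕜)) Z =
        divergence (pderiv (R := 𝕜)) (fun i => u * w i • X i) +
          (t * N : ℤ) * divergence (pderiv (R := 𝕜)) Y := by
      simp only [divergence, hZ, Pi.add_apply, Pi.smul_apply, map_add, Finset.sum_add_distrib,
        Int.cast_smul_eq_zsmul, map_zsmul, Finset.mul_sum]
      simp only [zsmul_eq_mul]
    have h2 : divergence (pderiv (R := 𝕜)) (fun i => w i • (X i : 𝐏)) =
        ((∑ i, w i : ℤ) : 𝐏) := by simp [divergence]
    rw [h1, divergence_mul, ← eulerD_eq_dirDeriv, hu, h2, hu', he, zsmul_eq_mul]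
    push_cast
    ring
  obtain ⟨V, hV0, hV⟩ := exists_divFree_of_dirDeriv_eq_zero (f := f) hX (Z := Z) (by
    rw [hadd, eulerD_eq hf, hu', zsmul_eq_mul]
    push_cast
    linear_combination (N : 𝐏) * hY)
  refine ⟨((t * N : ℤ) : 𝕜)⁻¹ • V, ?_, ?_⟩
  · simp only [divergence, Pi.smul_apply, Derivation.map_smul, ← Finset.smul_sum] at hV0 ⊢
    rw [hV0, smul_zero]
  · have : dirDeriv pderiv (((t * N : ℤ) : 𝕜)⁻¹ • V) f =
        ((t * N : ℤ) : 𝕜)⁻¹ • dirDeriv pderiv V f := by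
      simp only [dirDeriv, Pi.smul_apply, smul_mul_assoc, Finset.smul_sum]
    rw [this, ← hV, hdivZ, eq_inv_smul_iff₀ hc, Int.cast_smul_eq_zsmul, zsmul_eq_mul]

/-! ### Expansions in powers of `f` modulo twisted divergences. -/

theorem sum_Icc_pow_succ (f : 𝐏) (h : ℕ → 𝐏) (t : ℕ) :
    ∑ j ∈ Finset.Icc 1 (t + 1), f ^ (t + 1 - j) * h j =
      h (t + 1) + f * ∑ j ∈ Finset.Icc 1 t, f ^ (t - j) * h j := by
  rw [Finset.sum_Icc_succ_top (by omega), add_comm, Nat.sub_self, pow_zero, one_mul,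
    Finset.mul_sum]
  congr 1
  refine Finset.sum_congr rfl fun j hj => ?_
  rw [Nat.sub_add_comm (Finset.mem_Icc.1 hj).2, pow_succ]
  ring

theorem isWeightedHomogeneous_sum (hf : f.IsWeightedHomogeneous w N) {t : ℕ} {h : ℕ → 𝐏} {W : ℤ}
    (hh : ∀ j ∈ Finset.Icc 1 t, (h j).IsWeightedHomogeneous w (j * N - W)) :
    (∑ j ∈ Finset.Icc 1 t, f ^ (t - j) * h j).IsWeightedHomogeneous w (t * N - W) := by
  refine IsWeightedHomogeneous.sum _ _ _ fun j hj => ?_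
  convert! (hf.pow (t - j)).mul (hh j hj) using 1
  rw [nsmul_eq_mul, Nat.cast_sub (Finset.mem_Icc.1 hj).2]
  ring

/-- Modulo `f` and the derivatives of `f`, the basis monomials are independent. -/
theorem eq_zero_of_add_mul_eq [CharZero 𝕜] (hN : N ≠ 0) (hf : f.IsWeightedHomogeneous w N)
    (hli : ∀ b ∈ monomialSpan 𝕜 𝓑, ∀ Y, b = dirDeriv pderiv Y f → b = 0) {b : 𝐏}
    (hb : b ∈ monomialSpan 𝕜 𝓑) {G : 𝐏} {Y : Fin n → 𝐏} (h : b + f * G = dirDeriv pderiv Y f) :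
    b = 0 := by
  -- Euler's identity gives `f G = N⁻¹ G E(f)`, which is absorbed into the vector field.
  refine hli b hb (Y - (N : 𝕜)⁻¹ • fun i => G * w i • X i) ?_
  have hE := eulerD_eq hf
  have hc : (N : 𝕜) ≠ 0 := by exact_mod_cast hN
  have : dirDeriv pderiv (Y - (N : 𝕜)⁻¹ • fun i => G * w i • X i) f =
      dirDeriv pderiv Y f - (N : 𝕜)⁻¹ • (G * eulerD pderiv X w f) := by
    rw [eulerD_eq_dirDeriv, ← dirDeriv_mul]
    simp only [dirDeriv, Pi.sub_apply, Pi.smul_apply, sub_mul, Finset.sum_sub_distrib,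
      smul_mul_assoc, Finset.smul_sum]
  rw [this, hE, ← h, mul_smul_comm, ← Int.cast_smul_eq_zsmul 𝕜, inv_smul_smul₀ hc]
  ring

/-- Cancelling `f` leaves `V(f)` with `div V = 0`. The leading coefficient then vanishes modulo the
Jacobian ideal, and the rest satisfies the same equation with the twist lowered by one. -/
theorem coeffs_eq_zero [CharZero 𝕜] (hn : 2 ≤ n) (hw : ∀ i, 0 < w i) (hN : N ≠ 0)
    (hf : f.IsWeightedHomogeneous w N)
    (hX : ∃ M : ℕ, ∀ k, (X k ^ M : 𝐏) ∈ Ideal.span (Set.range fun i => pderiv i f))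
    (hli : ∀ b ∈ monomialSpan 𝕜 𝓑, ∀ Y, b = dirDeriv pderiv Y f → b = 0) (t : ℕ) (h : ℕ → 𝐏)
    (h1 : (h 1).IsWeightedHomogeneous w (N - ∑ i, w i))
    (hj : ∀ j, 2 ≤ j → j ≤ t + 1 → h j ∈ monomialSpan 𝕜 (ofDegree w 𝓑 (j * N - ∑ i, w i)))
    (Y : Fin n → 𝐏) (hY : f * ∑ j ∈ Finset.Icc 1 (t + 1), f ^ (t + 1 - j) * h j =
      twistedDiv pderiv f 1 (-((t + 1 : ℕ) : 𝕜)) Y) :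
    ∀ j ∈ Finset.Icc 1 (t + 1), h j = 0 := by
  induction t generalizing Y with
  | zero =>
    simp only [zero_add, Finset.Icc_self, Finset.sum_singleton, Nat.sub_self, pow_zero,
      one_mul] at hY
    obtain ⟨V, -, hV⟩ := exists_divFree_of_mul_eq hN hf hX one_ne_zero
      (by simpa using h1) hY
    rw [← twistedDiv_zero_one] at hV
    obtain ⟨V, hVh, hV⟩ := exists_homogeneous_of_twistedDiv_eq hf h1 hV
    -- The component `V i` has degree `w i - ∑ w_j`, which is negative because `n ≥ 2`.
    have hV0 : V = 0 := by
      funext i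
      refine (hVh i).eq_zero_of_no_monomials fun m => ?_
      obtain ⟨j, hji⟩ : ∃ j, j ≠ i := by
        have : Nontrivial (Fin n) := Fin.nontrivial_iff_two_le.2 hn
        exact exists_ne i
      have hlt : w i + w j ≤ ∑ i, w i := by
        rw [← Finset.sum_pair hji.symm]
        exact Finset.sum_le_sum_of_subset_of_nonneg (Finset.subset_univ _)
          fun k _ _ => (hw k).le
      have hm : 0 ≤ Finsupp.weight w m := by
        rw [Finsupp.weight_apply]
        exact Finset.sum_nonneg fun k _ => nsmul_nonneg (hw k).le _
      have := hw j
      omega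
    intro j hj1
    obtain rfl : j = 1 := by simpa using hj1
    rw [hV, hV0, map_zero]
  | succ t ih =>
    have hhom : ∀ j ∈ Finset.Icc 1 (t + 2), (h j).IsWeightedHomogeneous w (j * N - ∑ i, w i) := by
      intro j hj'
      rw [Finset.mem_Icc] at hj'
      rcases Nat.lt_or_ge 1 j with hlt | hle
      · exact isWeightedHomogeneous_of_mem_monomialSpan (hj j hlt hj'.2)
      · obtain rfl : j = 1 := by omega
        simpa using h1
    obtain ⟨V, hV0, hV⟩ := exists_divFree_of_mul_eq hN hf hX (t + 1).succ_ne_zero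
      (isWeightedHomogeneous_sum hf hhom) hY
    rw [sum_Icc_pow_succ] at hV
    have htop : h (t + 2) = 0 := eq_zero_of_add_mul_eq hN hf hli
      (monomialSpan_mono (ofDegree_subset _ _) (hj (t + 2) (by omega) le_rfl)) hV
    rw [htop, zero_add] at hV
    have hc : ((t + 1 : ℕ) : 𝕜) ≠ 0 := Nat.cast_ne_zero.2 t.succ_ne_zero
    have := ih (fun j h2 hjt => hj j h2 (by omega)) (-((t + 1 : ℕ) : 𝕜)⁻¹ • V) (by
      rw [map_smul, twistedDiv_apply, hV0, hV, mul_zero, smul_zero, zero_add, smul_smul,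
        neg_mul_neg, inv_mul_cancel₀ hc, one_smul])
    intro j hj'
    rw [Finset.mem_Icc] at hj'
    rcases Nat.lt_or_ge j (t + 2) with hlt | hle
    · exact this j (Finset.mem_Icc.2 ⟨hj'.1, by omega⟩)
    · obtain rfl : j = t + 2 := by omega
      exact htop

/-- At twist `t + 1`, `Y(f)` is traded for `f div Y / (t + 1)`, and the new factor already has the
degree required at twist `t`, so no Euler correction is needed. -/
theorem exists_coeffs [CharZero 𝕜] (hbas : ∀ (d : ℤ) (p : 𝐏), p.IsWeightedHomogeneous w d →
      ∃ b ∈ monomialSpan 𝕜 (ofDegree w 𝓑 d), ∃ Y : Fin n → 𝐏,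
        (∀ i, (Y i).IsWeightedHomogeneous w (d - N + w i)) ∧ p = b + dirDeriv pderiv Y f)
    (t : ℕ) (p : 𝐏) (hp : p.IsWeightedHomogeneous w ((t + 1 : ℕ) * N - ∑ i, w i)) :
    ∃ h : ℕ → 𝐏, (∀ j, j ∉ Finset.Icc 1 (t + 1) → h j = 0) ∧
      (h 1).IsWeightedHomogeneous w (N - ∑ i, w i) ∧
      (∀ j, 2 ≤ j → j ≤ t + 1 → h j ∈ monomialSpan 𝕜 (ofDegree w 𝓑 (j * N - ∑ i, w i))) ∧
      ∃ Y, p - ∑ j ∈ Finset.Icc 1 (t + 1), f ^ (t + 1 - j) * h j =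
        twistedDiv pderiv f 1 (-(t : 𝕜)) Y := by
  induction t generalizing p with
  | zero =>
    -- At twist `0` the term `Y(f)` is absent from the operator, so nothing can be traded and all of
    -- `p` is kept as `h 1`.
    refine ⟨Pi.single 1 p, fun j hj => Pi.single_eq_of_ne (by rintro rfl; simp at hj) _, ?_, ?_, 0,
      ?_⟩
    · simpa using hp
    · intro j h2 h1; omega
    · simp
  | succ t ih =>
    obtain ⟨b, hb, Y, hY, hpb⟩ := hbas _ _ hp
    have hc : ((t + 1 : ℕ) : 𝕜) ≠ 0 := Nat.cast_ne_zero.2 t.succ_ne_zero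
    have hdiv := isWeightedHomogeneous_smul (isWeightedHomogeneous_divergence
      (d := ((t + 1 : ℕ) : ℤ) * N - ∑ i, w i) fun i => by
        convert! hY i using 1; push_cast; ring) ((t + 1 : ℕ) : 𝕜)⁻¹
    obtain ⟨h, h0, h1, hj, Y', hY'⟩ := ih _ hdiv
    refine ⟨Function.update h (t + 2) b, fun j hj' => ?_, ?_, fun j h2 hjt => ?_,
      (-((t + 1 : ℕ) : 𝕜)⁻¹ • Y) + fun i => f * Y' i, ?_⟩
    · rw [Finset.mem_Icc] at hj'
      rw [Function.update_of_ne (by omega)]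
      exact h0 j (by rw [Finset.mem_Icc]; omega)
    · rwa [Function.update_of_ne (by omega)]
    · rcases eq_or_ne j (t + 2) with rfl | hne
      · rwa [Function.update_self]
      · rw [Function.update_of_ne hne]
        exact hj j h2 (by omega)
    · have hsum : ∑ j ∈ Finset.Icc 1 (t + 1),
          f ^ (t + 1 - j) * Function.update h (t + 2) b j =
          ∑ j ∈ Finset.Icc 1 (t + 1), f ^ (t + 1 - j) * h j :=
        Finset.sum_congr rfl fun j hj' => by
          rw [Function.update_of_ne (by have := (Finset.mem_Icc.1 hj').2; omega)]
      have htw : (-((t + 1 : ℕ) : 𝕜) + 1) = -(t : 𝕜) := by push_cast; ring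
      rw [sum_Icc_pow_succ, Function.update_self, hsum, map_add, twistedDiv_mul, htw, ← hY',
        map_smul, twistedDiv_apply, hpb, smul_add, smul_smul, smul_smul, neg_mul_neg,
        inv_mul_cancel₀ hc, one_smul, mul_one, neg_smul, mul_sub, mul_smul_comm]
      ring

end Polynomial

end NambuPoisson

namespace NambuPoisson

/-! ### Parametric integrals -/

section ParametricIntegral

open MeasureTheory Set

variable {E : Type} [NormedAddCommGroup E]

/-! ### Uniform bounds along the segment `[0, 1]`. -/

section Bound

variable {F : Type} [NormedAddCommGroup F]

/-- A tube argument around the compact `[0, 1] × {x₀}`; it supplies the dominating constants for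
continuity and differentiation under the integral. -/
theorem exists_bound_of_continuousOn {φ : ℝ × E → F} {W : Set (ℝ × E)} (hW : IsOpen W)
    (hφ : ContinuousOn φ W) {x₀ : E} (hx₀ : ∀ s ∈ Icc (0 : ℝ) 1, (s, x₀) ∈ W) :
    ∃ C : ℝ, ∀ᶠ x in 𝓝 x₀, ∀ s ∈ Icc (0 : ℝ) 1, (s, x) ∈ W ∧ ‖φ (s, x)‖ ≤ C := by
  have hK : IsCompact ((fun s : ℝ => (s, x₀)) '' Icc 0 1) :=
    isCompact_Icc.image (by fun_prop)
  obtain ⟨C, hC⟩ := hK.exists_bound_of_continuousOn (f := φ)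
    (hφ.mono (by rintro _ ⟨s, hs, rfl⟩; exact hx₀ s hs))
  refine ⟨C + 1, ?_⟩
  have h : ∀ s ∈ Icc (0 : ℝ) 1, ∀ᶠ p : E × ℝ in 𝓝 (x₀, s),
      (p.2, p.1) ∈ W ∧ ‖φ (p.2, p.1)‖ ≤ C + 1 := by
    intro s hs
    have hcont : ContinuousAt φ (s, x₀) := hφ.continuousAt (hW.mem_nhds (hx₀ s hs))
    have hlt : ‖φ (s, x₀)‖ < C + 1 := lt_of_le_of_lt (hC _ ⟨s, hs, rfl⟩) (lt_add_one C)
    have hswap : Tendsto (fun p : E × ℝ => (p.2, p.1)) (𝓝 (x₀, s)) (𝓝 (s, x₀)) :=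
      continuous_swap.tendsto (x₀, s)
    filter_upwards [hswap (hW.mem_nhds (hx₀ s hs)),
      (hcont.norm.tendsto.comp hswap).eventually (gt_mem_nhds hlt)] with p h1 h2
    exact ⟨h1, h2.le⟩
  exact isCompact_Icc.eventually_forall_of_forall_eventually
    (P := fun x s => (s, x) ∈ W ∧ ‖φ (s, x)‖ ≤ C + 1) h

theorem continuousOn_slice {φ : ℝ × E → F} {W : Set (ℝ × E)} (hφ : ContinuousOn φ W) {x : E}
    (hx : ∀ s ∈ Icc (0 : ℝ) 1, (s, x) ∈ W) : ContinuousOn (fun s => φ (s, x)) (Icc 0 1) :=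
  hφ.comp (by fun_prop) hx

theorem aestronglyMeasurable_slice {φ : ℝ × E → F} {W : Set (ℝ × E)} (hφ : ContinuousOn φ W)
    {x : E} (hx : ∀ s ∈ Icc (0 : ℝ) 1, (s, x) ∈ W) :
    AEStronglyMeasurable (fun s => φ (s, x)) (volume.restrict (uIoc 0 1)) := by
  rw [uIoc_of_le zero_le_one]
  exact ((continuousOn_slice hφ hx).mono Ioc_subset_Icc_self).aestronglyMeasurable
    measurableSet_Ioc

end Bound

variable [NormedSpace ℝ E]

/-- Integrals over `[0, 1]` of functions of class `C^k` in all variables are of class `C^k` in the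
parameter. -/
theorem contDiffOn_parametric_integral (k : ℕ) {F : Type} [NormedAddCommGroup F]
    [NormedSpace ℝ F] {φ : ℝ × E → F} {W : Set (ℝ × E)} (hW : IsOpen W)
    (hφ : ContDiffOn ℝ k φ W) {B : Set E} (hB : IsOpen B)
    (hBW : ∀ x ∈ B, ∀ s ∈ Icc (0 : ℝ) 1, (s, x) ∈ W) :
    ContDiffOn ℝ k (fun x => ∫ s in (0 : ℝ)..1, φ (s, x)) B := by
  have hIoc : ∀ s ∈ uIoc (0 : ℝ) 1, s ∈ Icc (0 : ℝ) 1 := fun s hs => by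
    rw [uIoc_of_le zero_le_one] at hs
    exact Ioc_subset_Icc_self hs
  induction k generalizing F with
  | zero =>
    rw [CharP.cast_eq_zero, contDiffOn_zero] at hφ ⊢
    intro x₀ hx₀
    obtain ⟨C, hC⟩ := exists_bound_of_continuousOn hW hφ (hBW x₀ hx₀)
    refine (intervalIntegral.continuousAt_of_dominated_interval (bound := fun _ => C) ?_ ?_
      intervalIntegrable_const ?_).continuousWithinAt
    · filter_upwards [hC] with x hx
      exact aestronglyMeasurable_slice hφ fun s hs => (hx s hs).1
    · filter_upwards [hC] with x hx
      exact ae_of_all _ fun s hs => (hx s (hIoc s hs)).2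
    · refine ae_of_all _ fun s hs => ?_
      have : ContinuousAt φ (s, x₀) := hφ.continuousAt (hW.mem_nhds (hBW x₀ hx₀ s (hIoc s hs)))
      exact this.comp (f := fun x => (s, x)) (by fun_prop)
  | succ k ih =>
    have hφ' := (contDiffOn_succ_iff_fderiv_of_isOpen (n := (k : WithTop ℕ∞)) hW).1
      (by exact_mod_cast hφ)
    -- The derivative in the parameter. It takes values in `E →L[ℝ] F`, which is why the induction
    -- runs over all targets.
    set ψ : ℝ × E → (E →L[ℝ] F) := fun p =>
      (fderiv ℝ φ p).comp (ContinuousLinearMap.inr ℝ ℝ E) with hψ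
    have hψk : ContDiffOn ℝ k ψ W := hφ'.2.2.clm_comp contDiffOn_const
    have hder : ∀ x₀ ∈ B, HasFDerivAt (fun x => ∫ s in (0 : ℝ)..1, φ (s, x))
        (∫ s in (0 : ℝ)..1, ψ (s, x₀)) x₀ := by
      intro x₀ hx₀
      obtain ⟨C, hC⟩ := exists_bound_of_continuousOn hW hψk.continuousOn (hBW x₀ hx₀)
      refine intervalIntegral.hasFDerivAt_integral_of_dominated_of_fderiv_le
        (F := fun x s => φ (s, x)) (F' := fun x s => ψ (s, x)) (bound := fun _ => C)
        (s := {x | ∀ s ∈ Icc (0 : ℝ) 1, (s, x) ∈ W ∧ ‖ψ (s, x)‖ ≤ C}) hC ?_ ?_ ?_ ?_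
        intervalIntegrable_const ?_
      · filter_upwards [hC] with x hx
        exact aestronglyMeasurable_slice hφ.continuousOn fun s hs => (hx s hs).1
      · refine ContinuousOn.intervalIntegrable ?_
        rw [uIcc_of_le zero_le_one]
        exact continuousOn_slice hφ.continuousOn (hBW x₀ hx₀)
      · exact aestronglyMeasurable_slice hψk.continuousOn (hBW x₀ hx₀)
      · exact ae_of_all _ fun s hs x hx => (hx s (hIoc s hs)).2
      · refine ae_of_all _ fun s hs x hx => ?_
        have h1 : HasFDerivAt φ (fderiv ℝ φ (s, x)) (s, x) :=
          (hφ'.1.differentiableAt (hW.mem_nhds (hx s (hIoc s hs)).1)).hasFDerivAt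
        exact h1.comp x (hasFDerivAt_prodMk_right s x)
    rw [show ((k + 1 : ℕ) : WithTop ℕ∞) = (k : WithTop ℕ∞) + 1 by push_cast; rfl,
      contDiffOn_succ_iff_fderiv_of_isOpen hB]
    refine ⟨fun x hx => (hder x hx).differentiableAt.differentiableWithinAt, fun h => ?_, ?_⟩
    · exact absurd h (by simp)
    · exact (ih hψk).congr fun x hx => (hder x hx).fderiv

end ParametricIntegral

/-! ### Quasihomogeneous dilations -/

section Dilation

open MeasureTheory Set

variable {𝕜 : Type} [RCLike 𝕜] {n : ℕ}

/-- The dilation `x ↦ (s^{a₁} x₁, …, s^{aₙ} xₙ)`. -/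
noncomputable def dilation (𝕜 : Type) [RCLike 𝕜] {n : ℕ} (a : Fin n → ℕ) (s : ℝ) :
    (Fin n → 𝕜) →L[𝕜] (Fin n → 𝕜) :=
  ContinuousLinearMap.pi fun i => ((s : 𝕜) ^ a i) • ContinuousLinearMap.proj i

variable (a : Fin n → ℕ)

theorem dilation_apply (s : ℝ) (x : Fin n → 𝕜) (i : Fin n) :
    dilation 𝕜 a s x i = (s : 𝕜) ^ a i * x i := rfl

theorem dilation_one (x : Fin n → 𝕜) : dilation 𝕜 a 1 x = x := by
  ext i; simp [dilation_apply]

theorem dilation_mul (s t : ℝ) (x : Fin n → 𝕜) :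
    dilation 𝕜 a s (dilation 𝕜 a t x) = dilation 𝕜 a (t * s) x := by
  ext i; simp only [dilation_apply, RCLike.ofReal_mul]; ring

theorem dilation_zero (ha : ∀ i, 0 < a i) (x : Fin n → 𝕜) : dilation 𝕜 a 0 x = 0 := by
  ext i; simp [dilation_apply, (ha i).ne']

theorem continuous_dilation_apply :
    Continuous fun p : ℝ × (Fin n → 𝕜) => dilation 𝕜 a p.1 p.2 := by
  refine continuous_pi fun i => ?_
  simp only [dilation_apply]
  fun_prop

theorem norm_dilation_apply_le {s : ℝ} (hs : s ∈ Icc (0 : ℝ) 1) (x : Fin n → 𝕜) :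
    ‖dilation 𝕜 a s x‖ ≤ ‖x‖ := by
  refine (pi_norm_le_iff_of_nonneg (norm_nonneg x)).2 fun i => ?_
  rw [dilation_apply, norm_mul, norm_pow, RCLike.norm_ofReal, abs_of_nonneg hs.1]
  exact (mul_le_of_le_one_left (norm_nonneg _) (pow_le_one₀ hs.1 hs.2)).trans (norm_le_pi_norm x i)

theorem norm_dilation_le {s : ℝ} (hs : s ∈ Icc (0 : ℝ) 1) : ‖dilation 𝕜 a s‖ ≤ 1 :=
  ContinuousLinearMap.opNorm_le_bound _ zero_le_one fun x => by
    rw [one_mul]; exact norm_dilation_apply_le a hs x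

theorem continuous_dilation : Continuous (dilation 𝕜 a) := by
  have : dilation 𝕜 a = fun s : ℝ => ∑ i, ((s : 𝕜) ^ a i) •
      ((ContinuousLinearMap.single 𝕜 (fun _ : Fin n => 𝕜) i).comp
        (ContinuousLinearMap.proj (φ := fun _ : Fin n => 𝕜) i)) := by
    funext s
    ext x i
    simp [dilation_apply, Finset.sum_apply, Pi.single_apply]
  rw [this]
  fun_prop

theorem hasDerivAt_dilation (s : ℝ) (x : Fin n → 𝕜) :
    HasDerivAt (fun s => dilation 𝕜 a s x)
      (fun i => (a i : 𝕜) * (s : 𝕜) ^ (a i - 1) * x i) s := by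
  refine hasDerivAt_pi.2 fun i => ?_
  have h : HasDerivAt (fun s : ℝ => (s : 𝕜)) 1 s := by
    simpa using (RCLike.ofRealCLM (K := 𝕜)).hasDerivAt (x := s)
  have h2 := (h.pow (a i)).mul_const (x i)
  rw [mul_one] at h2
  exact h2

/-- The Euler operator `∑ aᵢ xᵢ ∂ᵢ` on functions. -/
noncomputable def eulerFun (g : (Fin n → 𝕜) → 𝕜) (x : Fin n → 𝕜) : 𝕜 :=
  ∑ i, (a i : 𝕜) * (x i * fderiv 𝕜 g x (Pi.single i 1))

theorem eulerFun_eq (g : (Fin n → 𝕜) → 𝕜) (x : Fin n → 𝕜) :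
    eulerFun a g x = fderiv 𝕜 g x fun i => a i * x i := by
  conv_rhs => rw [← ContinuousLinearMap.coe_coe, LinearMap.pi_apply_eq_sum_univ]
  refine Finset.sum_congr rfl fun i _ => ?_
  have he : (fun j => if i = j then (1 : 𝕜) else 0) = Pi.single i 1 := by
    ext j; simp [Pi.single_apply, eq_comm]
  rw [smul_eq_mul, mul_assoc, he]
  rfl

theorem hasDerivAt_comp_dilation {g : (Fin n → 𝕜) → 𝕜} {s : ℝ} {x : Fin n → 𝕜}
    (hg : DifferentiableAt 𝕜 g (dilation 𝕜 a s x)) :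
    HasDerivAt (fun s => g (dilation 𝕜 a s x))
      (fderiv 𝕜 g (dilation 𝕜 a s x) fun i => (a i : 𝕜) * (s : 𝕜) ^ (a i - 1) * x i) s := by
  have h := (hg.hasFDerivAt.restrictScalars ℝ).comp_hasDerivAt s (hasDerivAt_dilation a s x)
  exact h

/-- A function killed by the Euler operator is constant. -/
theorem eq_const_of_eulerFun_eq_zero (ha : ∀ i, 0 < a i) {g : (Fin n → 𝕜) → 𝕜} {x : Fin n → 𝕜}
    (hg : ∀ s ∈ Icc (0 : ℝ) 1, DifferentiableAt 𝕜 g (dilation 𝕜 a s x))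
    (h0 : ∀ s ∈ Icc (0 : ℝ) 1, eulerFun a g (dilation 𝕜 a s x) = 0) : g x = g 0 := by
  have hcont : ContinuousOn (fun s => g (dilation 𝕜 a s x)) (Icc 0 1) := fun s hs =>
    (hasDerivAt_comp_dilation a (hg s hs)).continuousAt.continuousWithinAt
  -- Along a dilation orbit, `s` times the `s`-derivative of `g` is the Euler operator. This says
  -- nothing at `s = 0`, which is reached by continuity.
  have hder : ∀ s ∈ Ioc (0 : ℝ) 1, HasDerivAt (fun s => g (dilation 𝕜 a s x)) 0 s := by
    intro s hs
    have hs' := Ioc_subset_Icc_self hs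
    convert! hasDerivAt_comp_dilation a (hg s hs') using 1
    have h1 := h0 s hs'
    rw [eulerFun_eq] at h1
    have hs0 : (s : 𝕜) ≠ 0 := by exact_mod_cast hs.1.ne'
    have h2 : (fun i => (a i : 𝕜) * dilation 𝕜 a s x i) =
        (s : 𝕜) • fun i => (a i : 𝕜) * (s : 𝕜) ^ (a i - 1) * x i := by
      ext i
      rw [Pi.smul_apply, dilation_apply, smul_eq_mul]
      obtain ⟨m, hm⟩ : ∃ m, a i = m + 1 := ⟨a i - 1, by have := ha i; omega⟩
      rw [hm, Nat.add_sub_cancel, pow_succ]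
      ring
    rw [h2, map_smul, smul_eq_mul] at h1
    exact ((mul_eq_zero.1 h1).resolve_left hs0).symm
  have hconst : ∀ ε ∈ Ioc (0 : ℝ) 1, g (dilation 𝕜 a ε x) = g x := by
    intro ε hε
    have := constant_of_has_deriv_right_zero (a := ε) (b := 1)
      (hcont.mono (Icc_subset_Icc_left hε.1.le))
      (fun s hs => (hder s ⟨hε.1.trans_le hs.1, hs.2.le⟩).hasDerivWithinAt) 1
      (right_mem_Icc.2 hε.2)
    rw [dilation_one] at this
    exact this.symm
  have hlim : Tendsto (fun s => g (dilation 𝕜 a s x)) (𝓝[Ioc 0 1] 0) (𝓝 (g 0)) := by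
    have := (hcont 0 (left_mem_Icc.2 zero_le_one)).mono Ioc_subset_Icc_self
    simpa [ContinuousWithinAt, dilation_zero a ha] using this
  have hlim' : Tendsto (fun s => g (dilation 𝕜 a s x)) (𝓝[Ioc 0 1] 0) (𝓝 (g x)) :=
    tendsto_const_nhds.congr' (by
      filter_upwards [self_mem_nhdsWithin] with s hs using (hconst s hs).symm)
  have : (𝓝[Ioc (0 : ℝ) 1] 0).NeBot := by
    rw [nhdsWithin_Ioc_eq_nhdsGT zero_lt_one]
    infer_instance
  exact tendsto_nhds_unique hlim' hlim

/-- The solution of `(E + k + 1) u = g`. -/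
noncomputable def eulerSol (k : ℕ) (g : (Fin n → 𝕜) → 𝕜) (x : Fin n → 𝕜) : 𝕜 :=
  ∫ s in (0 : ℝ)..1, (s : 𝕜) ^ k * g (dilation 𝕜 a s x)

/-- Rescaling `s` gives `t^(k+1) u(t·x) = ∫_0^t s^k g(s·x) ds`; differentiate both sides at `t = 1`.
-/
theorem eulerFun_eulerSol (k : ℕ) {g : (Fin n → 𝕜) → 𝕜} {δ : ℝ}
    (hg : ContinuousOn g (Metric.ball 0 δ)) {x : Fin n → 𝕜} (hx : x ∈ Metric.ball 0 δ)
    (hu : DifferentiableAt 𝕜 (eulerSol a k g) x) :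
    eulerFun a (eulerSol a k g) x + (k + 1) * eulerSol a k g x = g x := by
  set G : ℝ → 𝕜 := fun s => (s : 𝕜) ^ k * g (dilation 𝕜 a s x) with hG
  have hscale : ∀ t : ℝ, ∫ s in (0 : ℝ)..t, G s =
      (t : 𝕜) ^ (k + 1) * eulerSol a k g (dilation 𝕜 a t x) := by
    intro t
    have h1 := intervalIntegral.smul_integral_comp_mul_left (a := 0) (b := 1) G t
    rw [mul_zero, mul_one] at h1
    rw [← h1, eulerSol, RCLike.real_smul_eq_coe_mul, pow_succ', mul_assoc]
    congr 1
    rw [← intervalIntegral.integral_const_mul]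
    congr 1
    funext s
    simp only [hG, dilation_mul, RCLike.ofReal_mul, mul_pow]
    ring
  have hcs : Continuous fun s => dilation 𝕜 a s x :=
    (continuous_dilation_apply a).comp (by fun_prop : Continuous fun s : ℝ => (s, x))
  have hopen : IsOpen {s : ℝ | dilation 𝕜 a s x ∈ Metric.ball 0 δ} :=
    Metric.isOpen_ball.preimage hcs
  have hGc : ContinuousOn G {s : ℝ | dilation 𝕜 a s x ∈ Metric.ball 0 δ} :=
    (by fun_prop : Continuous fun s : ℝ => (s : 𝕜) ^ k).continuousOn.mul
      (hg.comp hcs.continuousOn fun s hs => hs)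
  have hIcc : Icc (0 : ℝ) 1 ⊆ {s : ℝ | dilation 𝕜 a s x ∈ Metric.ball 0 δ} := fun s hs => by
    rw [mem_ball_zero_iff] at hx
    simpa using (norm_dilation_apply_le a hs x).trans_lt hx
  have h1mem := hIcc (right_mem_Icc.2 zero_le_one)
  have hd1 : HasDerivAt (fun t => ∫ s in (0 : ℝ)..t, G s) (G 1) 1 :=
    intervalIntegral.integral_hasDerivAt_right
      (ContinuousOn.intervalIntegrable (by rw [uIcc_of_le zero_le_one]; exact hGc.mono hIcc))
      (hGc.stronglyMeasurableAtFilter hopen _ h1mem) (hGc.continuousAt (hopen.mem_nhds h1mem))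
  have hu' : DifferentiableAt 𝕜 (eulerSol a k g) (dilation 𝕜 a 1 x) := by rwa [dilation_one]
  have hpow : HasDerivAt (fun t : ℝ => (t : 𝕜) ^ (k + 1)) (k + 1 : 𝕜) 1 := by
    have h : HasDerivAt (fun s : ℝ => (s : 𝕜)) 1 1 := by
      simpa using (RCLike.ofRealCLM (K := 𝕜)).hasDerivAt (x := 1)
    have h2 := h.pow (k + 1)
    simp only [Nat.add_sub_cancel, RCLike.ofReal_one, one_pow, mul_one, Nat.cast_add,
      Nat.cast_one] at h2
    exact h2
  have hd2 := hpow.mul (hasDerivAt_comp_dilation a hu')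
  have := hd1.unique (hd2.congr_of_eventuallyEq (Eventually.of_forall hscale))
  simp only [hG, dilation_one, RCLike.ofReal_one, one_pow, one_mul, mul_one] at this
  rw [this, eulerFun_eq]
  ring

/-- `eulerSol` preserves smoothness. -/
theorem contDiffOn_eulerSol (a : Fin n → ℕ) (k : ℕ) {g : (Fin n → ℝ) → ℝ} {δ : ℝ}
    (hg : ContDiffOn ℝ ∞ g (Metric.ball 0 δ)) :
    ContDiffOn ℝ ∞ (eulerSol a k g) (Metric.ball 0 δ) := by
  rw [contDiffOn_infty]
  intro m
  have hdil : ContDiff ℝ ∞ fun p : ℝ × (Fin n → ℝ) => dilation ℝ a p.1 p.2 := by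
    rw [contDiff_pi]
    intro i
    simp only [dilation_apply, RCLike.ofReal_real_eq_id, id]
    fun_prop
  refine contDiffOn_parametric_integral m
    (φ := fun p => ((p.1 : ℝ) : ℝ) ^ k * g (dilation ℝ a p.1 p.2))
    (W := {p | dilation ℝ a p.1 p.2 ∈ Metric.ball 0 δ})
    (Metric.isOpen_ball.preimage (continuous_dilation_apply a)) ?_ Metric.isOpen_ball
    fun x hx s hs => ?_
  · refine ContDiffOn.of_le (n := ∞) ?_ (by exact_mod_cast le_top)
    refine ContDiffOn.mul (by fun_prop) ?_
    exact hg.comp hdil.contDiffOn fun p hp => hp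
  · rw [mem_ball_zero_iff] at hx
    simpa using (norm_dilation_apply_le a hs x).trans_lt hx

/-- `eulerSol` preserves analyticity. -/
theorem analyticAt_eulerSol (k : ℕ) {g : (Fin n → 𝕜) → 𝕜} (hg : AnalyticAt 𝕜 g 0) :
    AnalyticAt 𝕜 (eulerSol a k g) 0 := by
  obtain ⟨p, r, hp⟩ := hg
  set T : ∀ m : ℕ, ℝ → ContinuousMultilinearMap 𝕜 (fun _ : Fin m => Fin n → 𝕜) 𝕜 := fun m s =>
    ((s : 𝕜) ^ k) • (p m).compContinuousLinearMap (fun _ => dilation 𝕜 a s) with hT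
  have hTc : ∀ m, Continuous (T m) := fun m =>
    (by fun_prop : Continuous fun s : ℝ => (s : 𝕜) ^ k).smul
      ((ContinuousMultilinearMap.compContinuousLinearMapLRight (p m)).cont.comp
        (continuous_pi fun _ => continuous_dilation a))
  have hTle : ∀ m, ∀ s ∈ Icc (0 : ℝ) 1, ‖T m s‖ ≤ ‖p m‖ := by
    intro m s hs
    have h1 : ‖(s : 𝕜) ^ k‖ ≤ 1 := by
      rw [norm_pow, RCLike.norm_ofReal, abs_of_nonneg hs.1]
      exact pow_le_one₀ hs.1 hs.2
    have h2 := (p m).norm_compContinuousLinearMap_le (fun _ => dilation 𝕜 a s)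
    have h3 : ∏ _i : Fin m, ‖dilation 𝕜 a s‖ ≤ 1 :=
      Finset.prod_le_one (fun _ _ => norm_nonneg _) fun _ _ => norm_dilation_le a hs
    calc ‖T m s‖ ≤ ‖(s : 𝕜) ^ k‖ * ‖(p m).compContinuousLinearMap (fun _ => dilation 𝕜 a s)‖ :=
          ContinuousMultilinearMap.opNorm_smul_le _ _
      _ ≤ 1 * (‖p m‖ * 1) := by gcongr; exact h2.trans (by gcongr)
      _ = ‖p m‖ := by ring
  have hIoc : ∀ s ∈ uIoc (0 : ℝ) 1, s ∈ Icc (0 : ℝ) 1 := fun s hs => by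
    rw [uIoc_of_le zero_le_one] at hs
    exact Ioc_subset_Icc_self hs
  -- The power series of `g` is integrated term by term. Dilations with `s ∈ [0, 1]` do not increase
  -- norms, so the radius of convergence does not shrink.
  set Q : FormalMultilinearSeries 𝕜 (Fin n → 𝕜) 𝕜 := fun m => ∫ s in (0 : ℝ)..1, T m s with hQ
  have hQle : ∀ m, ‖Q m‖ ≤ ‖p m‖ := fun m => by
    simpa using intervalIntegral.norm_integral_le_of_norm_le_const
      fun s hs => hTle m s (hIoc s hs)
  have hQa : ∀ m y, Q m (fun _ => y) =
      ∫ s in (0 : ℝ)..1, (s : 𝕜) ^ k * p m fun _ => dilation 𝕜 a s y := fun m y =>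
    ((ContinuousMultilinearMap.apply 𝕜 (fun _ : Fin m => Fin n → 𝕜) 𝕜
      fun _ => y).intervalIntegral_comp_comm ((hTc m).intervalIntegrable 0 1)).symm
  refine ⟨Q, r, hp.r_le.trans (FormalMultilinearSeries.radius_le_of_le hQle), hp.r_pos, ?_⟩
  intro y hy
  simp only [hQa, zero_add, eulerSol]
  have hys : ∀ s ∈ Icc (0 : ℝ) 1, dilation 𝕜 a s y ∈ Metric.eball (0 : Fin n → 𝕜) r := by
    intro s hs
    rw [mem_eball_zero_iff] at hy ⊢
    refine lt_of_le_of_lt ?_ hy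
    rw [enorm_le_iff_norm_le]
    exact norm_dilation_apply_le a hs y
  have hsum : Summable fun m => ‖p m‖ * ‖y‖ ^ m := by
    refine p.summable_norm_mul_pow (r := ‖y‖₊) (lt_of_lt_of_le ?_ hp.r_le)
    rwa [mem_eball_zero_iff] at hy
  refine intervalIntegral.hasSum_integral_of_dominated_convergence
    (fun m _ => ‖p m‖ * ‖y‖ ^ m) (fun m => ?_) (fun m => ?_) (ae_of_all _ fun _ _ => hsum)
    intervalIntegrable_const (ae_of_all _ fun s hs => ?_)
  · exact ((ContinuousMultilinearMap.apply 𝕜 (fun _ : Fin m => Fin n → 𝕜) 𝕜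
      fun _ => y).continuous.comp (hTc m)).aestronglyMeasurable
  · refine ae_of_all _ fun s hs => ?_
    have h1 : ‖T m s fun _ => y‖ ≤ ‖T m s‖ * ∏ _i : Fin m, ‖y‖ := (T m s).le_opNorm _
    rw [Finset.prod_const, Finset.card_univ, Fintype.card_fin] at h1
    exact h1.trans (by gcongr; exact hTle m s (hIoc s hs))
  · have := hp.hasSum (hys s (hIoc s hs))
    rw [zero_add] at this
    exact this.mul_left _

end Dilation

end NambuPoisson

namespace NambuPoisson

/-! ### The Euler derivation on rings of germs -/

/-! ### Formal power series. -/

section Formal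

variable (𝕜 : Type) [RCLike 𝕜] {n : ℕ}

theorem coeff_X_mul_pderiv (i : Fin n) (g : MvPowerSeries (Fin n) 𝕜) (m : Fin n →₀ ℕ) :
    MvPowerSeries.coeff m (MvPowerSeries.X i * MvPowerSeries.pderiv 𝕜 i g) =
      m i * MvPowerSeries.coeff m g := by
  rw [MvPowerSeries.X, MvPowerSeries.coeff_monomial_mul]
  split_ifs with h
  · rw [MvPowerSeries.coeff_pderiv, tsub_add_cancel_of_le h, one_mul, Finsupp.tsub_apply,
      Finsupp.single_eq_same, ← Nat.cast_add_one, Nat.sub_add_cancel (by simpa using h), mul_comm]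
  · have : m i = 0 := by
      by_contra h0
      exact h (by simpa [Nat.one_le_iff_ne_zero] using h0)
    simp [this]

theorem coeff_eulerD_formal (w : Fin n → ℤ) (g : MvPowerSeries (Fin n) 𝕜) (m : Fin n →₀ ℕ) :
    MvPowerSeries.coeff m (eulerD (MvPowerSeries.pderiv 𝕜) MvPowerSeries.X w g) =
      (Finsupp.weight w m : ℤ) * MvPowerSeries.coeff m g := by
  rw [eulerD_apply, map_sum, Finsupp.weight_apply, Finsupp.sum_fintype _ _ (by simp),
    Int.cast_sum, Finset.sum_mul]
  refine Finset.sum_congr rfl fun i _ => ?_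
  rw [map_zsmul, coeff_X_mul_pderiv, zsmul_eq_mul, nsmul_eq_mul]
  push_cast
  ring

theorem weight_pos {w : Fin n → ℤ} (hw : ∀ i, 0 < w i) {m : Fin n →₀ ℕ} (hm : m ≠ 0) :
    0 < Finsupp.weight w m := by
  obtain ⟨i, hi⟩ : ∃ i, m i ≠ 0 := by
    by_contra! h
    exact hm (Finsupp.ext h)
  rw [Finsupp.weight_apply, Finsupp.sum_fintype _ _ (by simp)]
  refine Finset.sum_pos' (fun j _ => nsmul_nonneg (hw j).le _) ⟨i, Finset.mem_univ i, ?_⟩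
  exact nsmul_pos (hw i) hi

/-- The constant coefficient as a homomorphism of algebras. -/
noncomputable def formalEval (n : ℕ) : (formalGerms 𝕜 n).carrier →ₐ[𝕜] 𝕜 where
  toRingHom := MvPowerSeries.constantCoeff (σ := Fin n) (R := 𝕜)
  commutes' r := MvPowerSeries.constantCoeff_C (σ := Fin n) r

/-- `E` multiplies the coefficient at `m` by the weight of `m`, positive for `m ≠ 0`, so everything
is solved coefficientwise. -/
theorem isEulerRing_formal (w : Fin n → ℤ) (hw : ∀ i, 0 < w i) :
    IsEulerRing (formalGerms 𝕜 n) w (formalEval 𝕜 n) where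
  pd_coord i j := by
    refine (MvPowerSeries.pderiv_X (R := 𝕜) i j).trans ?_
    rw [Pi.single_apply]
    simp only [eq_comm (a := j)]
    rfl
  ev_coord i := MvPowerSeries.constantCoeff_X i
  exists_euler l hl g := by
    refine ⟨fun m => ((Finsupp.weight w m + l : ℤ) : 𝕜)⁻¹ * MvPowerSeries.coeff m g, ?_⟩
    refine MvPowerSeries.ext fun m => ?_
    have hpos : ((Finsupp.weight w m + l : ℤ) : 𝕜) ≠ 0 := by
      have h0 : 0 ≤ Finsupp.weight w m := by
        rcases eq_or_ne m 0 with rfl | hm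
        · simp
        · exact (weight_pos hw hm).le
      exact_mod_cast (by omega : Finsupp.weight w m + l ≠ 0)
    refine (map_add (MvPowerSeries.coeff m) _ _).trans ?_
    refine (congrArg₂ (· + ·) (coeff_eulerD_formal 𝕜 w _ m)
      (map_zsmul (MvPowerSeries.coeff m) l _)).trans ?_
    change _ * (((Finsupp.weight w m + l : ℤ) : 𝕜)⁻¹ * MvPowerSeries.coeff m g) +
      l • (((Finsupp.weight w m + l : ℤ) : 𝕜)⁻¹ * MvPowerSeries.coeff m g) = _
    rw [zsmul_eq_mul, ← add_mul, ← Int.cast_add, mul_inv_cancel_left₀ hpos]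
  const_of_euler g hg := by
    refine MvPowerSeries.ext fun m => ?_
    have h1 := (coeff_eulerD_formal 𝕜 w g m).symm.trans
      ((congrArg (MvPowerSeries.coeff m) hg).trans (map_zero _))
    change _ = MvPowerSeries.coeff m (MvPowerSeries.C (MvPowerSeries.constantCoeff g))
    rw [MvPowerSeries.coeff_C]
    split_ifs with hm
    · subst hm; rfl
    · refine (mul_eq_zero.1 h1).resolve_left ?_
      exact_mod_cast (weight_pos hw hm).ne'

end Formal

/-! ### Germs of analytic and smooth functions. -/

section Functions

variable {𝕜 : Type} [RCLike 𝕜] {n : ℕ} {r : WithTop ℕ∞}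

/-- The value at the origin. -/
noncomputable def germEval (hr : r + 1 ≤ r) : (germRing 𝕜 n r hr).carrier →ₐ[𝕜] 𝕜 where
  toRingHom := (Germ.valueRingHom (x := (0 : Fin n → 𝕜)) (E := 𝕜)).comp
    (germSubalgebra 𝕜 n r).val.toRingHom
  commutes' c := by
    change Germ.value (algebraMap 𝕜 (Germ (𝓝 (0 : Fin n → 𝕜)) 𝕜) c) = c
    rw [Algebra.algebraMap_eq_smul_one]
    change c * 1 = c
    exact mul_one c

/-- The germ of a function of class `C^r`. -/
def toGerm (hr : r + 1 ≤ r) (g : (Fin n → 𝕜) → 𝕜) (hg : ∀ᶠ x in 𝓝 0, ContDiffAt 𝕜 r g x) :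
    (germRing 𝕜 n r hr).carrier :=
  (⟨(g : Germ (𝓝 (0 : Fin n → 𝕜)) 𝕜), g, hg, rfl⟩ : germSubalgebra 𝕜 n r)

theorem exists_eq_toGerm (hr : r + 1 ≤ r) (g : (germRing 𝕜 n r hr).carrier) :
    ∃ a ha, g = toGerm hr a ha := by
  obtain ⟨_, a, ha, rfl⟩ := g
  exact ⟨a, ha, rfl⟩

theorem coe_eulerD_toGerm (hr : r + 1 ≤ r) {w : Fin n → ℤ} (a : Fin n → ℕ) (ha : ∀ i, w i = a i)
    (g : (Fin n → 𝕜) → 𝕜) (hg : ∀ᶠ x in 𝓝 0, ContDiffAt 𝕜 r g x) :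
    (eulerD (germRing 𝕜 n r hr).pd (germRing 𝕜 n r hr).coord w (toGerm hr g hg) :
      germSubalgebra 𝕜 n r).1 = (eulerFun a g : Germ (𝓝 (0 : Fin n → 𝕜)) 𝕜) := by
  have h1 : (eulerFun a g : Germ (𝓝 (0 : Fin n → 𝕜)) 𝕜) =
      ∑ i, ((fun x => (a i : 𝕜) * (x i * fderiv 𝕜 g x (Pi.single i 1)) : (Fin n → 𝕜) → 𝕜) :
        Germ (𝓝 (0 : Fin n → 𝕜)) 𝕜) := by
    have := map_sum (Germ.coeAddHom (M := 𝕜) (𝓝 (0 : Fin n → 𝕜)))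
      (fun i => (fun x => (a i : 𝕜) * (x i * fderiv 𝕜 g x (Pi.single i 1)) : (Fin n → 𝕜) → 𝕜))
      Finset.univ
    refine Eq.trans ?_ this
    congr 1
    funext x
    simp [eulerFun]
  rw [h1, eulerD_apply]
  refine (map_sum (germSubalgebra 𝕜 n r).val _ _).trans ?_
  refine Finset.sum_congr rfl fun i _ => ?_
  rw [ha i, natCast_zsmul]
  refine (map_nsmul (germSubalgebra 𝕜 n r).val _ _).trans ?_
  refine (Germ.coe_eq.2 ?_ : (((a i) • fun x : Fin n → 𝕜 =>
    x i * fderiv 𝕜 g x (Pi.single i 1) : (Fin n → 𝕜) → 𝕜) : Germ (𝓝 (0 : Fin n → 𝕜)) 𝕜) = _)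
  exact .of_forall fun x => nsmul_eq_mul _ _

theorem eventually_differentiableAt (hr : r + 1 ≤ r) {g : (Fin n → 𝕜) → 𝕜}
    (hg : ∀ᶠ x in 𝓝 0, ContDiffAt 𝕜 r g x) : ∀ᶠ x in 𝓝 0, DifferentiableAt 𝕜 g x := by
  have hr1 : r ≠ 0 := by rintro rfl; simp at hr
  filter_upwards [hg] with x hx using hx.differentiableAt hr1

/-- `hsol` isolates the regularity of the integral solution, the only point where the smooth and
analytic cases need different arguments. -/
theorem isEulerRing_germRing (hr : r + 1 ≤ r) (w : Fin n → ℤ) (hw : ∀ i, 0 < w i)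
    (hsol : ∀ (a : Fin n → ℕ) (k : ℕ) (g : (Fin n → 𝕜) → 𝕜),
      (∀ᶠ x in 𝓝 0, ContDiffAt 𝕜 r g x) → ∀ᶠ x in 𝓝 0, ContDiffAt 𝕜 r (eulerSol a k g) x) :
    IsEulerRing (germRing 𝕜 n r hr) w (germEval hr) where
  pd_coord i j := by
    refine Subtype.ext (Eq.trans (b := ((fun _ => if i = j then 1 else 0 : (Fin n → 𝕜) → 𝕜) :
      Germ (𝓝 (0 : Fin n → 𝕜)) 𝕜)) (Germ.coe_eq.2 (.of_forall fun x => ?_)) ?_)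
    · have h := (ContinuousLinearMap.proj (R := 𝕜) (φ := fun _ : Fin n => 𝕜) j).fderiv (x := x)
      change fderiv 𝕜 (ContinuousLinearMap.proj (R := 𝕜) (φ := fun _ : Fin n => 𝕜) j) x
        (Pi.single i 1) = _
      rw [h]
      simp [Pi.single_apply, eq_comm]
    · split_ifs <;> rfl
  ev_coord i := rfl
  exists_euler l hl g := by
    obtain ⟨g, hg, rfl⟩ := exists_eq_toGerm hr g
    obtain ⟨k, rfl⟩ : ∃ k : ℕ, l = (k + 1 : ℕ) := ⟨(l - 1).toNat, by omega⟩
    set a : Fin n → ℕ := fun i => (w i).toNat with ha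
    have haw : ∀ i, w i = a i := fun i => (Int.toNat_of_nonneg (hw i).le).symm
    have hu := hsol a k g hg
    refine ⟨toGerm hr (eulerSol a k g) hu, Subtype.ext ?_⟩
    obtain ⟨δ, hδ, hball⟩ := Metric.eventually_nhds_iff_ball.1
      (eventually_differentiableAt hr hg)
    have hcont : ContinuousOn g (Metric.ball 0 δ) := fun x hx =>
      (hball x hx).continuousAt.continuousWithinAt
    refine (congrArg (· + ((((k + 1 : ℕ) : ℤ) • eulerSol a k g : (Fin n → 𝕜) → 𝕜) :
      Germ (𝓝 (0 : Fin n → 𝕜)) 𝕜)) (coe_eulerD_toGerm hr a haw (eulerSol a k g) hu)).trans ?_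
    refine Germ.coe_eq.2 ?_
    filter_upwards [eventually_differentiableAt hr hu, Metric.ball_mem_nhds 0 hδ] with x h1 h2
    rw [← eulerFun_eulerSol a k hcont h2 h1]
    simp
  const_of_euler g hg := by
    obtain ⟨g, hg', rfl⟩ := exists_eq_toGerm hr g
    set a : Fin n → ℕ := fun i => (w i).toNat with ha
    have haw : ∀ i, w i = a i := fun i => (Int.toNat_of_nonneg (hw i).le).symm
    have h0 : eulerFun a g =ᶠ[𝓝 0] fun _ => 0 :=
      Germ.coe_eq.1 ((coe_eulerD_toGerm hr a haw g hg').symm.trans (congrArg Subtype.val hg))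
    obtain ⟨δ, hδ, hball⟩ := Metric.eventually_nhds_iff_ball.1
      ((eventually_differentiableAt hr hg').and h0)
    refine Subtype.ext (Eq.trans (b := ((fun _ => g 0 : (Fin n → 𝕜) → 𝕜) :
      Germ (𝓝 (0 : Fin n → 𝕜)) 𝕜)) (Germ.coe_eq.2 ?_) ?_)
    · filter_upwards [Metric.ball_mem_nhds 0 hδ] with x hx
      have hmem : ∀ s ∈ Set.Icc (0 : ℝ) 1, dilation 𝕜 a s x ∈ Metric.ball 0 δ := fun s hs => by
        rw [mem_ball_zero_iff] at hx ⊢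
        exact (norm_dilation_apply_le a hs x).trans_lt hx
      refine eq_const_of_eulerFun_eq_zero a (fun i => ?_) (fun s hs => (hball _ (hmem s hs)).1)
        fun s hs => (hball _ (hmem s hs)).2
      have := hw i
      rw [haw] at this
      exact_mod_cast this
    · change _ = algebraMap 𝕜 (Germ (𝓝 (0 : Fin n → 𝕜)) 𝕜) (g 0)
      rw [Algebra.algebraMap_eq_smul_one]
      exact Germ.coe_eq.2 (.of_forall fun x => (mul_one (g 0)).symm)

theorem eventually_contDiffAt_omega_eulerSol (a : Fin n → ℕ) (k : ℕ) (g : (Fin n → 𝕜) → 𝕜)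
    (hg : ∀ᶠ x in 𝓝 0, ContDiffAt 𝕜 ω g x) : ∀ᶠ x in 𝓝 0, ContDiffAt 𝕜 ω (eulerSol a k g) x := by
  have h := analyticAt_eulerSol a k hg.self_of_nhds.analyticAt
  filter_upwards [h.eventually_analyticAt] with x hx using hx.contDiffAt

theorem eventually_contDiffAt_infty_eulerSol (a : Fin n → ℕ) (k : ℕ) (g : (Fin n → ℝ) → ℝ)
    (hg : ∀ᶠ x in 𝓝 0, ContDiffAt ℝ ∞ g x) : ∀ᶠ x in 𝓝 0, ContDiffAt ℝ ∞ (eulerSol a k g) x := by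
  obtain ⟨δ, hδ, hball⟩ := Metric.eventually_nhds_iff_ball.1 hg
  have h := contDiffOn_eulerSol a k (δ := δ) fun x hx => (hball x hx).contDiffWithinAt
  filter_upwards [Metric.isOpen_ball.mem_nhds (Metric.mem_ball_self hδ)] with x hx
  exact h.contDiffAt (Metric.isOpen_ball.mem_nhds hx)

end Functions

theorem IsGermRing.exists_isEulerRing {n : ℕ} {𝕜 : Type} [RCLike 𝕜] {𝓕 : FunctionRing 𝕜 n}
    (h𝓕 : IsGermRing n 𝕜 𝓕) (w : Fin n → ℤ) (hw : ∀ i, 0 < w i) :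
    ∃ ev, IsEulerRing 𝓕 w ev := by
  cases h𝓕 with
  | holomorphic =>
    exact ⟨_, isEulerRing_germRing le_top w hw eventually_contDiffAt_omega_eulerSol⟩
  | realAnalytic =>
    exact ⟨_, isEulerRing_germRing le_top w hw eventually_contDiffAt_omega_eulerSol⟩
  | smooth =>
    exact ⟨_, isEulerRing_germRing le_rfl w hw eventually_contDiffAt_infty_eulerSol⟩
  | formal => exact ⟨_, isEulerRing_formal 𝕜 w hw⟩

end NambuPoisson

namespace NambuPoisson

open MvPolynomial FunctionRing

/-! ### Forms of top degree -/

section Forms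

variable {𝕜 : Type} [Field 𝕜] {m : ℕ} (𝓕 : FunctionRing 𝕜 (m + 1))

/-- The full set of indices. -/
def topIdx (m : ℕ) : {J : Finset (Fin (m + 1)) // J.card = m + 1} := ⟨Finset.univ, by simp⟩

theorem eq_topIdx (J : {J : Finset (Fin (m + 1)) // J.card = m + 1}) : J = topIdx m :=
  Subtype.ext ((Finset.card_eq_iff_eq_univ _).1 (by rw [J.2, Fintype.card_fin]))

theorem eq_volForm (α : 𝓕.Form (m + 1)) : α = 𝓕.volForm (α (topIdx m)) := by
  funext J
  rw [eq_topIdx J]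
  rfl

/-- The complement of an index. -/
def coIdx (i : Fin (m + 1)) : {I : Finset (Fin (m + 1)) // I.card = m} :=
  eraseIdx (topIdx m) ⟨i, Finset.mem_univ i⟩

theorem coIdx_injective : Function.Injective (coIdx (m := m)) := by
  intro i j h
  have h' : Finset.univ.erase i = Finset.univ.erase j := congrArg Subtype.val h
  by_contra hij
  have : i ∈ Finset.univ.erase j := Finset.mem_erase.2 ⟨hij, Finset.mem_univ i⟩
  rw [← h'] at this
  exact Finset.notMem_erase _ _ this

theorem insertSign_smul_smul {A : Type*} [CommRing A] (J : Finset (Fin (m + 1))) (i : Fin (m + 1))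
    (a : A) : insertSign J i • insertSign J i • a = a := by
  rw [smul_smul, insertSign, ← mul_pow]
  simp

/-- The dictionary between `(n-1)`-forms and vector fields, with `n = m + 1` and `q = t + 1`: the
coefficient `k - p` at `k = n - 1` is `q - 1 = t`. -/
theorem twistedD_topIdx (f : 𝓕.carrier) (t : ℕ) (β : 𝓕.Form m) :
    𝓕.twistedD f ((m + 1 : ℕ) - (t + 1 : ℕ)) m β (topIdx m) =
      twistedDiv 𝓕.pd f 1 (-(t : 𝕜)) fun i => insertSign Finset.univ i • β (coIdx i) := by
  have h1 : 𝓕.extD m β (topIdx m) =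
      ∑ i, insertSign Finset.univ i • 𝓕.pd i (β (coIdx i)) :=
    Finset.sum_coe_sort Finset.univ fun i => insertSign Finset.univ i • 𝓕.pd i (β (coIdx i))
  have h2 : 𝓕.dWedge f m β (topIdx m) =
      ∑ i, insertSign Finset.univ i • (𝓕.pd i f * β (coIdx i)) :=
    Finset.sum_coe_sort Finset.univ fun i => insertSign Finset.univ i • (𝓕.pd i f * β (coIdx i))
  have h3 : 𝓕.twistedD f ((m + 1 : ℕ) - (t + 1 : ℕ)) m β (topIdx m) =
      f * 𝓕.extD m β (topIdx m) -
        ((m : ℤ) - ((m + 1 : ℕ) - (t + 1 : ℕ))) • 𝓕.dWedge f m β (topIdx m) := rfl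
  have h4 : ((m : ℤ) - ((m + 1 : ℕ) - (t + 1 : ℕ))) = t := by push_cast; ring
  rw [h3, h1, h2, h4, twistedDiv_apply, one_smul, neg_smul, Nat.cast_smul_eq_nsmul 𝕜,
    natCast_zsmul, ← sub_eq_add_neg]
  simp only [divergence, dirDeriv, map_zsmul, smul_mul_assoc, mul_comm (𝓕.pd _ f)]

theorem volForm_mem_coboundaries_iff (f g : 𝓕.carrier) (t : ℕ) :
    𝓕.volForm g ∈ 𝓕.coboundaries f ((m + 1 : ℕ) - (t + 1 : ℕ)) (m + 1) ↔
      ∃ Z, g = twistedDiv 𝓕.pd f 1 (-(t : 𝕜)) Z := by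
  constructor
  · rintro ⟨β, hβ⟩
    exact ⟨_, (congrFun hβ (topIdx m)).symm.trans (twistedD_topIdx 𝓕 f t β)⟩
  · rintro ⟨Z, rfl⟩
    refine ⟨fun I => ∑ i, if I = coIdx i then insertSign Finset.univ i • Z i else 0, ?_⟩
    rw [eq_volForm 𝓕 (𝓕.twistedD f _ m _)]
    congr 1
    rw [twistedD_topIdx]
    congr 1
    funext i
    simp only [coIdx_injective.eq_iff, Finset.sum_ite_eq, Finset.mem_univ, if_true,
      insertSign_smul_smul]

end Forms

/-! ### The normal form -/

section NormalForm

variable {𝕜 : Type} [Field 𝕜] [CharZero 𝕜] {n : ℕ} {w : Fin n → ℤ} {N : ℤ}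
  {𝓕 : FunctionRing 𝕜 n} {ev : 𝓕.carrier →ₐ[𝕜] 𝕜} {f : MvPolynomial (Fin n) 𝕜}
  {𝓑 : Finset (Fin n →₀ ℕ)}

/-- The space of the coefficient `h_j` in the normal form. -/
noncomputable def coeffSpace (𝕜 : Type) [Field 𝕜] {n : ℕ} (w : Fin n → ℤ) (N : ℤ)
    (𝓑 : Finset (Fin n →₀ ℕ)) (q j : ℕ) : Submodule 𝕜 (MvPolynomial (Fin n) 𝕜) :=
  if j = 1 then weightedHomogeneousSubmodule 𝕜 w (N - ∑ i, w i)
  else if j = q then monomialSpan 𝕜 𝓑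
  else monomialSpan 𝕜 (ofDegree w 𝓑 (j * N - ∑ i, w i))

/-- The only reduction made on germs. With `l = ∑ w_i - (t + 1) N`, multiples of the Euler field
show that `f (E + l) u` is a twisted divergence, so `div Z / (t + 1)` may be replaced by a
quasihomogeneous polynomial of degree `-l`, to which `exists_coeffs` applies. -/
theorem IsEulerRing.exists_normalForm (h𝓕 : IsEulerRing 𝓕 w ev) (hw : ∀ i, 0 < w i)
    (hf : f.IsWeightedHomogeneous w N) (h𝓑 : 𝓕.IsMonomialBasis (𝓕.ofPoly f) 𝓑) (t : ℕ)
    (g : 𝓕.carrier) : ∃ h : ℕ → MvPolynomial (Fin n) 𝕜,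
      (∀ j, j ∉ Finset.Icc 1 (t + 2) → h j = 0) ∧
      (∀ j ∈ Finset.Icc 1 (t + 2), h j ∈ coeffSpace 𝕜 w N 𝓑 (t + 2) j) ∧
      ∃ Z, g - 𝓕.ofPoly (∑ j ∈ Finset.Icc 1 (t + 2), f ^ (t + 2 - j) * h j) =
        twistedDiv 𝓕.pd (𝓕.ofPoly f) 1 (-((t + 1 : ℕ) : 𝕜)) Z := by
  obtain ⟨b, hb, Z, hg⟩ := exists_basis_add_dirDeriv h𝓑 g
  have hc : ((t + 1 : ℕ) : 𝕜) ≠ 0 := Nat.cast_ne_zero.2 t.succ_ne_zero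
  set l : ℤ := ∑ i, w i - (t + 1 : ℕ) * N with hl
  obtain ⟨u, p, hp, hup⟩ := h𝓕.exists_euler_add_poly hw (l.natAbs + 1) l (by omega)
    (((t + 1 : ℕ) : 𝕜)⁻¹ • divergence 𝓕.pd Z)
  rw [hl, neg_sub] at hp
  obtain ⟨h, h0, h1, hj, Y, hY⟩ :=
    exists_coeffs (fun d p => h𝓕.exists_poly_basis_add hw hf h𝓑 (d := d) (p := p)) t p hp
  refine ⟨Function.update h (t + 2) b, fun j hj' => ?_, fun j hj' => ?_,
    -((t + 1 : ℕ) : 𝕜)⁻¹ • Z + (fun i => u * w i • 𝓕.coord i) +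
      fun i => 𝓕.ofPoly f * 𝓕.ofPoly (Y i), ?_⟩
  · rw [Finset.mem_Icc] at hj'
    rw [Function.update_of_ne (by omega)]
    exact h0 j (by rw [Finset.mem_Icc]; omega)
  · rw [Finset.mem_Icc] at hj'
    unfold coeffSpace
    split_ifs with h1' h2'
    · subst h1'
      rw [Function.update_of_ne (by omega)]
      exact h1
    · subst h2'
      rwa [Function.update_self]
    · rw [Function.update_of_ne h2']
      exact hj j (by omega) (by omega)
  · have hsum : ∑ j ∈ Finset.Icc 1 (t + 1),
        f ^ (t + 1 - j) * Function.update h (t + 2) b j =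
        ∑ j ∈ Finset.Icc 1 (t + 1), f ^ (t + 1 - j) * h j :=
      Finset.sum_congr rfl fun j hj' => by
        rw [Function.update_of_ne (by have := (Finset.mem_Icc.1 hj').2; omega)]
    have htw : (-((t + 1 : ℕ) : 𝕜) + 1) = -(t : 𝕜) := by push_cast; ring
    have hEf : eulerD 𝓕.pd 𝓕.coord w (𝓕.ofPoly f) = N • 𝓕.ofPoly f := by
      rw [← map_zsmul, ← eulerD_eq hf, eulerD_apply, eulerD_apply, map_sum]
      simp [h𝓕.pd_ofPoly, ofPoly_X]
    rw [sum_Icc_pow_succ, Function.update_self, hsum, map_add, map_add, map_add, twistedDiv_mul, htw,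
      h𝓕.twistedDiv_ofPoly, ← hY, twistedDiv_euler h𝓕.pd_coord w hEf, map_smul,
      twistedDiv_apply, one_smul, smul_add, smul_smul, neg_mul_neg, inv_mul_cancel₀ hc, one_smul,
      neg_smul, ← mul_smul_comm, hup, hg]
    simp only [map_mul, map_sub]
    ring

theorem IsEulerRing.exists_X_pow_mem (h𝓕 : IsEulerRing 𝓕 w ev) (hw : ∀ i, 0 < w i)
    (hf : f.IsWeightedHomogeneous w N) (h𝓑 : 𝓕.IsMonomialBasis (𝓕.ofPoly f) 𝓑) :
    ∃ M : ℕ, ∀ k, (X k ^ M : MvPolynomial (Fin n) 𝕜) ∈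
      Ideal.span (Set.range fun i => pderiv i f) :=
  NambuPoisson.exists_X_pow_mem hw
    fun d p => h𝓕.exists_poly_basis_add hw hf h𝓑 (d := d) (p := p)

omit [CharZero 𝕜] in
-- The Jacobian ideal of `0` contains no power of a coordinate, so `f` has a monomial; it is not
-- constant, hence has positive weight.
theorem degree_ne_zero (hn : 0 < n) (hw : ∀ i, 0 < w i) (hf : f.IsWeightedHomogeneous w N)
    (hf0 : constantCoeff f = 0)
    (hX : ∃ M : ℕ, ∀ k, (X k ^ M : MvPolynomial (Fin n) 𝕜) ∈
      Ideal.span (Set.range fun i => pderiv i f)) : N ≠ 0 := by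
  obtain ⟨M, hM⟩ := hX
  have hfne : f ≠ 0 := by
    rintro rfl
    have := hM ⟨0, hn⟩
    have hbot : Ideal.span (Set.range fun i : Fin n =>
        pderiv i (0 : MvPolynomial (Fin n) 𝕜)) = ⊥ := by
      rw [Ideal.span_eq_bot]
      rintro _ ⟨i, rfl⟩
      exact map_zero _
    rw [hbot, Ideal.mem_bot] at this
    exact pow_ne_zero M (X_ne_zero _) this
  obtain ⟨m, hm⟩ := ne_zero_iff.1 hfne
  rw [← hf hm]
  refine (weight_pos hw ?_).ne'
  rintro rfl
  exact hm hf0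

theorem IsEulerRing.normalForm_eq_zero (h𝓕 : IsEulerRing 𝓕 w ev) (hn : 2 ≤ n)
    (hw : ∀ i, 0 < w i) (hf : f.IsWeightedHomogeneous w N) (hf0 : constantCoeff f = 0)
    (h𝓑 : 𝓕.IsMonomialBasis (𝓕.ofPoly f) 𝓑) (t : ℕ) (h : ℕ → MvPolynomial (Fin n) 𝕜)
    (hmem : ∀ j ∈ Finset.Icc 1 (t + 2), h j ∈ coeffSpace 𝕜 w N 𝓑 (t + 2) j)
    (Z : Fin n → 𝓕.carrier)
    (hZ : 𝓕.ofPoly (∑ j ∈ Finset.Icc 1 (t + 2), f ^ (t + 2 - j) * h j) =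
      twistedDiv 𝓕.pd (𝓕.ofPoly f) 1 (-((t + 1 : ℕ) : 𝕜)) Z) :
    ∀ j ∈ Finset.Icc 1 (t + 2), h j = 0 := by
  have hX := h𝓕.exists_X_pow_mem hw hf h𝓑
  have hN := degree_ne_zero (by omega) hw hf hf0 hX
  have hli : ∀ b ∈ monomialSpan 𝕜 𝓑, ∀ Y, b = dirDeriv pderiv Y f → b = 0 :=
    fun b hb Y hY => eq_zero_of_mem_monomialSpan h𝓑 hb (Z := fun i => 𝓕.ofPoly (Y i)) (by
      rw [← twistedDiv_zero_one, h𝓕.twistedDiv_ofPoly, twistedDiv_zero_one, hY])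
  obtain ⟨Y, hY⟩ := h𝓕.exists_poly_of_twistedDiv_eq hw hf hZ
  rw [sum_Icc_pow_succ] at hY
  have htop : h (t + 2) = 0 := by
    -- The top coefficient has no prescribed degree, so it is removed before the graded argument:
    -- modulo `f` the twisted divergence is a multiple of `Y(f)`.
    refine eq_zero_of_add_mul_eq hN hf hli (𝓑 := 𝓑) ?_ (Y := -((t + 1 : ℕ) : 𝕜) • Y)
      (G := ∑ j ∈ Finset.Icc 1 (t + 1), f ^ (t + 1 - j) * h j - divergence pderiv Y) ?_
    · simpa [coeffSpace] using hmem (t + 2) (by simp)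
    · have hsm : dirDeriv pderiv (-((t + 1 : ℕ) : 𝕜) • Y) f =
          -((t + 1 : ℕ) : 𝕜) • dirDeriv pderiv Y f := by
        simp only [dirDeriv, Pi.smul_apply, smul_mul_assoc, Finset.smul_sum]
      rw [twistedDiv_apply, one_smul] at hY
      rw [hsm, mul_sub]
      linear_combination hY
  rw [htop, zero_add] at hY
  have := coeffs_eq_zero hn hw hN hf hX hli t h
    (by simpa [coeffSpace] using hmem 1 (by simp))
    (fun j h2 hjt => by
      have := hmem j (Finset.mem_Icc.2 ⟨by omega, by omega⟩)
      rwa [coeffSpace, if_neg (by omega), if_neg (by omega)] at this) Y hY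
  intro j hj'
  rw [Finset.mem_Icc] at hj'
  rcases Nat.lt_or_ge j (t + 2) with hlt | hle
  · exact this j (Finset.mem_Icc.2 ⟨hj'.1, by omega⟩)
  · obtain rfl : j = t + 2 := by omega
    exact htop

end NormalForm

/-! ### Dimensions -/

section Dimension

variable {𝕜 : Type} [Field 𝕜] {n : ℕ} {w : Fin n → ℤ} {N : ℤ}

instance (𝓑 : Finset (Fin n →₀ ℕ)) : Module.Finite 𝕜 (monomialSpan 𝕜 𝓑) :=
  FiniteDimensional.span_of_finite 𝕜 (𝓑.finite_toSet.image _)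

theorem finrank_monomialSpan (𝓑 : Finset (Fin n →₀ ℕ)) :
    Module.finrank 𝕜 (monomialSpan 𝕜 𝓑) = 𝓑.card := by
  have hli : LinearIndependent 𝕜 fun m : 𝓑 => (monomial m.1 1 : MvPolynomial (Fin n) 𝕜) := by
    have := (basisMonomials (Fin n) 𝕜).linearIndependent
    rw [coe_basisMonomials] at this
    exact this.comp _ Subtype.val_injective
  have := finrank_span_eq_card hli
  rw [Fintype.card_coe] at this
  rw [← this, monomialSpan, Set.image_eq_range]
  rfl

/-- With weights at least one, each exponent of a monomial of weight `d` is at most `d.toNat`, so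
there are finitely many such monomials. -/
theorem finite_weightedHomogeneousSubmodule (hw : ∀ i, 0 < w i) (d : ℤ) :
    Module.Finite 𝕜 (weightedHomogeneousSubmodule 𝕜 w d) := by
  have hfin : {m : Fin n →₀ ℕ | Finsupp.weight w m = d}.Finite := by
    refine (Set.finite_Iic (Finsupp.equivFunOnFinite.symm fun _ => d.toNat)).subset fun m hm i => ?_
    have hm : Finsupp.weight w m = d := hm
    rw [Finsupp.weight_apply, Finsupp.sum_fintype _ _ (by simp)] at hm
    have h1 : m i • w i ≤ ∑ i, m i • w i :=
      Finset.single_le_sum (f := fun i => m i • w i) (fun j _ => nsmul_nonneg (hw j).le _)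
        (Finset.mem_univ i)
    have h2 : (m i : ℤ) ≤ m i • w i := by
      rw [nsmul_eq_mul]; exact le_mul_of_one_le_right (by positivity) (hw i)
    change m i ≤ d.toNat
    omega
  have hle : weightedHomogeneousSubmodule 𝕜 w d ≤ monomialSpan 𝕜 hfin.toFinset := by
    intro p hp
    rw [p.as_sum]
    refine sum_mem fun m hm => ?_
    rw [← mul_one (coeff m p), ← smul_eq_mul, ← smul_monomial]
    refine Submodule.smul_mem _ _ (Submodule.subset_span ⟨m, ?_, rfl⟩)
    simpa using hp (mem_support_iff.1 hm)
  exact Submodule.finiteDimensional_of_le hle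

theorem card_eq_finrank {𝓕 : FunctionRing 𝕜 n} {f : 𝓕.carrier} {𝓑 : Finset (Fin n →₀ ℕ)}
    (h𝓑 : 𝓕.IsMonomialBasis f 𝓑) : 𝓑.card = Module.finrank 𝕜 (𝓕.MilnorAlgebra f) := by
  have hspan := h𝓑.2
  rw [Set.image_eq_range] at hspan
  rw [Module.finrank_eq_card_basis (Module.Basis.mk h𝓑.1 hspan.ge), Fintype.card_coe]

theorem finite_coeffSpace (hw : ∀ i, 0 < w i) (𝓑 : Finset (Fin n →₀ ℕ)) (q j : ℕ) :
    Module.Finite 𝕜 (coeffSpace 𝕜 w N 𝓑 q j) := by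
  by_cases h1 : j = 1
  · rw [coeffSpace, if_pos h1]
    exact finite_weightedHomogeneousSubmodule hw _
  by_cases h2 : j = q
  · rw [coeffSpace, if_neg h1, if_pos h2]
    infer_instance
  · rw [coeffSpace, if_neg h1, if_neg h2]
    infer_instance

theorem sum_finrank_coeffSpace (𝓑 : Finset (Fin n →₀ ℕ)) (t : ℕ) :
    ∑ j ∈ Finset.Icc 1 (t + 2), Module.finrank 𝕜 (coeffSpace 𝕜 w N 𝓑 (t + 2) j) =
      𝓑.card + ∑ j ∈ Finset.Icc 2 (t + 1), (ofDegree w 𝓑 ((j : ℤ) * N - ∑ i, w i)).card +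
        Module.finrank 𝕜 (weightedHomogeneousSubmodule 𝕜 w (N - ∑ i, w i)) := by
  rw [Finset.sum_Icc_succ_top (by omega), ← Finset.add_sum_Ioc_eq_sum_Icc (by omega : 1 ≤ t + 1)]
  have h1 : ∑ j ∈ Finset.Ioc 1 (t + 1), Module.finrank 𝕜 (coeffSpace 𝕜 w N 𝓑 (t + 2) j) =
      ∑ j ∈ Finset.Icc 2 (t + 1), (ofDegree w 𝓑 ((j : ℤ) * N - ∑ i, w i)).card := by
    refine Finset.sum_congr rfl fun j hj => ?_
    rw [Finset.mem_Icc] at hj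
    rw [coeffSpace, if_neg (by omega), if_neg (by omega), finrank_monomialSpan]
  rw [h1, coeffSpace, if_pos rfl, coeffSpace, if_neg (by omega), if_pos rfl,
    finrank_monomialSpan]
  ring

end Dimension

theorem cocycles_top {𝕜 : Type} [Field 𝕜] {n : ℕ} (𝓕 : FunctionRing 𝕜 n) (f : 𝓕.carrier) (p : ℤ)
    (α : 𝓕.Form n) : α ∈ 𝓕.cocycles f p n := by
  rw [cocycles, LinearMap.mem_ker]
  funext J
  have := J.1.card_le_univ
  rw [J.2, Fintype.card_fin] at this
  omega

end NambuPoisson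

namespace NambuPoisson

open MvPolynomial FunctionRing

/-! ### Passage from normal forms to cohomology. -/

section Cohomology

variable {𝕜 : Type} [Field 𝕜] {n : ℕ} {w : Fin n → ℤ} {N : ℤ}
  {𝓕 : FunctionRing 𝕜 n} {ev : 𝓕.carrier →ₐ[𝕜] 𝕜} {f : MvPolynomial (Fin n) 𝕜}
  {𝓑 : Finset (Fin n →₀ ℕ)}

theorem volForm_sub (g g' : 𝓕.carrier) :
    𝓕.volForm g - 𝓕.volForm g' = 𝓕.volForm (g - g') := rfl

theorem exists_eq_volForm (hn : 0 < n) (α : 𝓕.Form n) : ∃ g, α = 𝓕.volForm g := by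
  obtain ⟨m, rfl⟩ : ∃ m, n = m + 1 := ⟨n - 1, by omega⟩
  exact ⟨_, eq_volForm 𝓕 α⟩

theorem volForm_mem_coboundaries (hn : 0 < n) (f g : 𝓕.carrier) (t : ℕ) :
    𝓕.volForm g ∈ 𝓕.coboundaries f ((n : ℤ) - (t + 2 : ℕ)) n ↔
      ∃ Z, g = twistedDiv 𝓕.pd f 1 (-((t + 1 : ℕ) : 𝕜)) Z := by
  obtain ⟨m, rfl⟩ : ∃ m, n = m + 1 := ⟨n - 1, by omega⟩
  exact volForm_mem_coboundaries_iff 𝓕 f g (t + 1)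

/-- The class of the form with given coefficients. -/
noncomputable def normalFormClass (𝓕 : FunctionRing 𝕜 n) (f : MvPolynomial (Fin n) 𝕜)
    (w : Fin n → ℤ) (N : ℤ) (𝓑 : Finset (Fin n →₀ ℕ)) (q : ℕ) (p : ℤ) :
    (∀ j : Finset.Icc 1 q, coeffSpace 𝕜 w N 𝓑 q j) →ₗ[𝕜] 𝓕.Cohomology (𝓕.ofPoly f) p n where
  toFun v := Submodule.Quotient.mk
    ⟨𝓕.volForm (𝓕.ofPoly (∑ j, f ^ (q - j.1) * (v j).1)), cocycles_top _ _ _ _⟩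
  map_add' v v' := by
    rw [← Submodule.Quotient.mk_add]
    congr 1
    refine Subtype.ext (funext fun _ => ?_)
    simp [volForm, mul_add, Finset.sum_add_distrib]
  map_smul' c v := by
    rw [RingHom.id_apply, ← Submodule.Quotient.mk_smul]
    congr 1
    refine Subtype.ext (funext fun _ => ?_)
    simp [volForm, Finset.smul_sum]

theorem normalFormClass_eq_iff {q : ℕ} {p : ℤ}
    (v : ∀ j : Finset.Icc 1 q, coeffSpace 𝕜 w N 𝓑 q j) (α : 𝓕.cocycles (𝓕.ofPoly f) p n) :
    normalFormClass 𝓕 f w N 𝓑 q p v = Submodule.Quotient.mk α ↔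
      (α : 𝓕.Form n) - 𝓕.volForm (𝓕.ofPoly (∑ j, f ^ (q - j.1) * (v j).1)) ∈
        𝓕.coboundaries (𝓕.ofPoly f) p n := by
  rw [eq_comm]
  exact Submodule.Quotient.eq ((𝓕.coboundaries (𝓕.ofPoly f) p n).submoduleOf
    (𝓕.cocycles (𝓕.ofPoly f) p n)) (x := α)
    (y := ⟨𝓕.volForm (𝓕.ofPoly (∑ j, f ^ (q - j.1) * (v j).1)), cocycles_top _ _ _ _⟩)

variable [CharZero 𝕜]

theorem IsEulerRing.exists_form (h𝓕 : IsEulerRing 𝓕 w ev) (hn : 2 ≤ n) (hw : ∀ i, 0 < w i)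
    (hf : f.IsWeightedHomogeneous w N) (h𝓑 : 𝓕.IsMonomialBasis (𝓕.ofPoly f) 𝓑) (t : ℕ)
    (α : 𝓕.Form n) : ∃ h : ℕ → MvPolynomial (Fin n) 𝕜,
      (∀ j, j ∉ Finset.Icc 1 (t + 2) → h j = 0) ∧
      (∀ j ∈ Finset.Icc 1 (t + 2), h j ∈ coeffSpace 𝕜 w N 𝓑 (t + 2) j) ∧
      α - 𝓕.volForm (𝓕.ofPoly (∑ j ∈ Finset.Icc 1 (t + 2), f ^ (t + 2 - j) * h j)) ∈
        𝓕.coboundaries (𝓕.ofPoly f) ((n : ℤ) - (t + 2 : ℕ)) n := by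
  obtain ⟨g, rfl⟩ := exists_eq_volForm (by omega) α
  obtain ⟨h, h0, h1, hZ⟩ := h𝓕.exists_normalForm hw hf h𝓑 t g
  exact ⟨h, h0, h1, (volForm_mem_coboundaries (by omega) _ _ t).2 hZ⟩

theorem IsEulerRing.form_eq_zero (h𝓕 : IsEulerRing 𝓕 w ev) (hn : 2 ≤ n)
    (hw : ∀ i, 0 < w i) (hf : f.IsWeightedHomogeneous w N) (hf0 : constantCoeff f = 0)
    (h𝓑 : 𝓕.IsMonomialBasis (𝓕.ofPoly f) 𝓑) (t : ℕ) (h : ℕ → MvPolynomial (Fin n) 𝕜)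
    (hmem : ∀ j ∈ Finset.Icc 1 (t + 2), h j ∈ coeffSpace 𝕜 w N 𝓑 (t + 2) j)
    (hZ : 𝓕.volForm (𝓕.ofPoly (∑ j ∈ Finset.Icc 1 (t + 2), f ^ (t + 2 - j) * h j)) ∈
      𝓕.coboundaries (𝓕.ofPoly f) ((n : ℤ) - (t + 2 : ℕ)) n) :
    ∀ j ∈ Finset.Icc 1 (t + 2), h j = 0 := by
  obtain ⟨Z, hZ⟩ := (volForm_mem_coboundaries (by omega) _ _ t).1 hZ
  exact h𝓕.normalForm_eq_zero hn hw hf hf0 h𝓑 t h hmem Z hZ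

/-- Injectivity is uniqueness of the normal form, surjectivity its existence; the dimension is then
the sum over the coefficient spaces. -/
theorem IsEulerRing.normalFormClass_bijective (h𝓕 : IsEulerRing 𝓕 w ev) (hn : 2 ≤ n)
    (hw : ∀ i, 0 < w i) (hf : f.IsWeightedHomogeneous w N) (hf0 : constantCoeff f = 0)
    (h𝓑 : 𝓕.IsMonomialBasis (𝓕.ofPoly f) 𝓑) (t : ℕ) : Function.Bijective
      (normalFormClass 𝓕 f w N 𝓑 (t + 2) ((n : ℤ) - (t + 2 : ℕ))) := by
  constructor
  · rw [injective_iff_map_eq_zero]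
    intro v hv
    have hv' := neg_mem ((normalFormClass_eq_iff v 0).1 (hv.trans
      (Submodule.Quotient.mk_zero _).symm))
    rw [ZeroMemClass.coe_zero, zero_sub, neg_neg] at hv'
    obtain ⟨h, hval⟩ : ∃ h : ℕ → MvPolynomial (Fin n) 𝕜,
        ∀ j : Finset.Icc 1 (t + 2), h j.1 = (v j).1 :=
      ⟨fun j => if hj : j ∈ Finset.Icc 1 (t + 2) then (v ⟨j, hj⟩).1 else 0, fun j => dif_pos j.2⟩
    have hmem : ∀ j ∈ Finset.Icc 1 (t + 2), h j ∈ coeffSpace 𝕜 w N 𝓑 (t + 2) j :=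
      fun j hj => (hval ⟨j, hj⟩).symm ▸ (v ⟨j, hj⟩).2
    have hsum : ∑ j : Finset.Icc 1 (t + 2), f ^ (t + 2 - j.1) * (v j).1 =
        ∑ j ∈ Finset.Icc 1 (t + 2), f ^ (t + 2 - j) * h j := by
      refine Eq.trans (Finset.sum_congr rfl fun j _ => by rw [hval]) (Finset.sum_coe_sort
        (Finset.Icc 1 (t + 2)) fun j => f ^ (t + 2 - j) * h j)
    rw [hsum] at hv'
    have := h𝓕.form_eq_zero hn hw hf hf0 h𝓑 t h hmem hv'
    funext j
    exact Subtype.ext ((hval j).symm.trans (this j.1 j.2))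
  · intro c
    obtain ⟨⟨α, hα⟩, rfl⟩ := Submodule.Quotient.mk_surjective _ c
    obtain ⟨h, -, hmem, hB⟩ := h𝓕.exists_form hn hw hf h𝓑 t α
    refine ⟨fun j => ⟨h j.1, hmem j.1 j.2⟩, ?_⟩
    rw [← Finset.sum_coe_sort (Finset.Icc 1 (t + 2)) fun j => f ^ (t + 2 - j) * h j] at hB
    exact (normalFormClass_eq_iff _ _).2 hB

theorem IsEulerRing.finrank_cohomology (h𝓕 : IsEulerRing 𝓕 w ev) (hn : 2 ≤ n)
    (hw : ∀ i, 0 < w i) (hf : f.IsWeightedHomogeneous w N) (hf0 : constantCoeff f = 0)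
    (h𝓑 : 𝓕.IsMonomialBasis (𝓕.ofPoly f) 𝓑) (t : ℕ) :
    Module.Finite 𝕜 (𝓕.Cohomology (𝓕.ofPoly f) ((n : ℤ) - (t + 2 : ℕ)) n) ∧
    Module.finrank 𝕜 (𝓕.Cohomology (𝓕.ofPoly f) ((n : ℤ) - (t + 2 : ℕ)) n) =
      Module.finrank 𝕜 (𝓕.MilnorAlgebra (𝓕.ofPoly f)) +
      ∑ j ∈ Finset.Icc 2 (t + 1), (ofDegree w 𝓑 ((j : ℤ) * N - ∑ i, w i)).card +
      Module.finrank 𝕜 (weightedHomogeneousSubmodule 𝕜 w (N - ∑ i, w i)) := by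
  have hbij := h𝓕.normalFormClass_bijective hn hw hf hf0 h𝓑 t
  have e := LinearEquiv.ofBijective _ hbij
  have hfin : ∀ j : Finset.Icc 1 (t + 2), Module.Finite 𝕜 (coeffSpace 𝕜 w N 𝓑 (t + 2) j) :=
    fun j => finite_coeffSpace hw 𝓑 _ _
  refine ⟨Module.Finite.equiv e, ?_⟩
  rw [← e.finrank_eq, Module.finrank_pi_fintype, Finset.sum_coe_sort (Finset.Icc 1 (t + 2))
    fun j => Module.finrank 𝕜 (coeffSpace 𝕜 w N 𝓑 (t + 2) j), sum_finrank_coeffSpace,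
    card_eq_finrank h𝓑]

end Cohomology

end NambuPoisson

theorem mainTheorem10 {𝕜 : Type} [RCLike 𝕜] (n : ℕ) (hn : 3 ≤ n)
    (𝓕 : NambuPoisson.FunctionRing 𝕜 n) (h𝓕 : NambuPoisson.IsGermRing n 𝕜 𝓕)
    (w : Fin n → ℤ) (hw : ∀ i, 0 < w i) (N : ℤ)
    (f : MvPolynomial (Fin n) 𝕜) (hfN : f.IsWeightedHomogeneous w N)
    (hf0 : MvPolynomial.constantCoeff f = 0)
    (hfin : Module.Finite 𝕜 (𝓕.MilnorAlgebra (𝓕.ofPoly f)))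
    (𝓑 : Finset (Fin n →₀ ℕ)) (h𝓑 : 𝓕.IsMonomialBasis (𝓕.ofPoly f) 𝓑)
    (q : ℕ) (hq : 1 < q) :
    (∀ α : 𝓕.Form n, ∃! h : ℕ → MvPolynomial (Fin n) 𝕜,
      (∀ j, j ∉ Finset.Icc 1 q → h j = 0) ∧
      (h 1).IsWeightedHomogeneous w (N - ∑ i, w i) ∧
      (∀ j, 2 ≤ j → j ≤ q - 1 →
        h j ∈ NambuPoisson.monomialSpan 𝕜
          (NambuPoisson.ofDegree w 𝓑 ((j : ℤ) * N - ∑ i, w i))) ∧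
      h q ∈ NambuPoisson.monomialSpan 𝕜 𝓑 ∧
      α - 𝓕.volForm (𝓕.ofPoly (∑ j ∈ Finset.Icc 1 q, f ^ (q - j) * h j)) ∈
        𝓕.coboundaries (𝓕.ofPoly f) ((n : ℤ) - q) n) ∧
    Module.Finite 𝕜 (𝓕.Cohomology (𝓕.ofPoly f) ((n : ℤ) - q) n) ∧
    Module.finrank 𝕜 (𝓕.Cohomology (𝓕.ofPoly f) ((n : ℤ) - q) n) =
      Module.finrank 𝕜 (𝓕.MilnorAlgebra (𝓕.ofPoly f)) +
      ∑ j ∈ Finset.Icc 2 (q - 1),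
        (NambuPoisson.ofDegree w 𝓑 ((j : ℤ) * N - ∑ i, w i)).card +
      Module.finrank 𝕜 (MvPolynomial.weightedHomogeneousSubmodule 𝕜 w (N - ∑ i, w i)) := by
  obtain ⟨ev, hE⟩ := h𝓕.exists_isEulerRing w hw
  obtain ⟨t, rfl⟩ : ∃ t, q = t + 2 := ⟨q - 2, by omega⟩
  have hn2 : 2 ≤ n := by omega
  refine ⟨fun α => ?_, ?_⟩
  -- Since `q = t + 2 ≥ 2`, the cases `j = 1`, `2 ≤ j ≤ q - 1` and `j = q` are disjoint and match
  -- the branches of `coeffSpace`.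
  · have hspace : ∀ h : ℕ → MvPolynomial (Fin n) 𝕜,
        (∀ j ∈ Finset.Icc 1 (t + 2), h j ∈ NambuPoisson.coeffSpace 𝕜 w N 𝓑 (t + 2) j) ↔
        (h 1).IsWeightedHomogeneous w (N - ∑ i, w i) ∧
        (∀ j, 2 ≤ j → j ≤ t + 2 - 1 → h j ∈ NambuPoisson.monomialSpan 𝕜
          (NambuPoisson.ofDegree w 𝓑 ((j : ℤ) * N - ∑ i, w i))) ∧
        h (t + 2) ∈ NambuPoisson.monomialSpan 𝕜 𝓑 := by
      intro h
      constructor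
      · intro hm
        refine ⟨by simpa [NambuPoisson.coeffSpace] using hm 1 (by simp), fun j h2 hj => ?_,
          by simpa [NambuPoisson.coeffSpace] using hm (t + 2) (by simp)⟩
        have := hm j (Finset.mem_Icc.2 ⟨by omega, by omega⟩)
        rwa [NambuPoisson.coeffSpace, if_neg (by omega), if_neg (by omega)] at this
      · rintro ⟨h1, hj, hq'⟩ j hjm
        rw [Finset.mem_Icc] at hjm
        unfold NambuPoisson.coeffSpace
        split_ifs with e1 e2
        · subst e1; exact h1
        · subst e2; exact hq'
        · exact hj j (by omega) (by omega)
    obtain ⟨h, h0, hm, hB⟩ := hE.exists_form hn2 hw hfN h𝓑 t α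
    have hm' := (hspace h).1 hm
    refine ⟨h, ⟨h0, hm'.1, hm'.2.1, hm'.2.2, hB⟩, ?_⟩
    rintro g ⟨g0, g1, gj, gq, gB⟩
    have gm := (hspace g).2 ⟨g1, gj, gq⟩
    have hzero := hE.form_eq_zero hn2 hw hfN hf0 h𝓑 t (g - h)
      (fun j hj => sub_mem (gm j hj) (hm j hj)) (by
        have := sub_mem hB gB
        rw [sub_sub_sub_cancel_left, NambuPoisson.volForm_sub, ← map_sub,
          ← Finset.sum_sub_distrib] at this
        simpa only [Pi.sub_apply, mul_sub] using this)
    funext j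
    by_cases hj : j ∈ Finset.Icc 1 (t + 2)
    · exact sub_eq_zero.1 (hzero j hj)
    · rw [g0 j hj, h0 j hj]
  · exact hE.finrank_cohomology hn2 hw hfN hf0 h𝓑 t
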